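/- Let a \emph{decision tree} over $x_1,\dots,x_n$ be a rooted binary tree whose internal nodes are labelled by variables and have two children (one for the value $0$, one for the value $1$) and whose leaves are labelled by $0$ or $1$; its size is its number of leaves. Let a \emph{branching program} over $x_1,\dots,x_n$ be a finite directed acyclic graph with a designated root and exactly two sinks, one labelled $0$ and one labelled $1$, in which every other node is labelled by a variable and has two outgoing edges, labelled $0$ and $1$; its size is its number of nodes (sinks included; nodes that are not reachable from the root are allowed). Both compute a Boolean function $\{0,1\}^n\to\{0,1\}$ by following, from the root, the edges determined by the input. For $n,s\ge 0$ let $\mathrm{DT}_{n,s}$ and $\mathrm{BP}_{n,s}$ be the classes of functions $\{0,1\}^n\to\{0,1\}$ computed by a decision tree, respectively a branching program, of size $s$. A randomized adaptive query algorithm has access to a function $f:\{0,1\}^n\to\{0,1\}$ through membership queries (given $x$, the answer is $f(x)$) and to a distribution $\mathcal D$ on $\{0,1\}^n$ through example queries (the answer is an independent random $x$ drawn from $\mathcal D$). It is an $\epsilon$-tester for a class $C$ with respect to $\mathcal D$ if it accepts with probability at least $2/3$ whenever $f\in C$, and rejects with probability at least $2/3$ whenever $\Pr_{x\in\mathcal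 D}[f(x)\ne g(x)]\ge\epsilon$ for every $g\in C$. It is an $\epsilon$-tester for $C$ in the uniform model if this holds for $\mathcal D$ uniform, and a distribution-free $\epsilon$-tester if it holds for every $\mathcal D$ (the algorithm does not depend on $\mathcal D$). Its query complexity is the maximal total number of queries of both kinds that it makes on any $f$. \textbf{Theorem.} There are constants $K,c$, independent of $n$, $s$ and $\epsilon$, such that for all $n,s$ and every $\epsilon>0$, for each of the two classes $C=\mathrm{DT}_{n,s}$ and $C=\mathrm{BP}_{n,s}$: 1. there is a (two-sided, adaptive) $\epsilon$-tester for $C$ in the uniform model with query complexity at most $K\,T\log^c(T+2)$ where $T=s/\epsilon$, i.e. $\tilde O(s/\epsilon)$; 2. there is a (two-sided, adaptive) distribution-free $\epsilon$-tester for $C$ with query complexity at most $K\,T\log^c(T+2)$ where $T=s^2/\epsilon$, i.e. $\tilde O(s^2/\epsilon)$. -/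

import Mathlib

/-- Boolean functions `{0,1}^n → {0,1}`. -/
abbrev BoolFn (n : ℕ) : Type := (Fin n → Bool) → Bool

/-! ## Decision trees -/

/-- Decision trees over the variables `x_0, …, x_{n-1}`. An internal node carries a variable, the
subtree for the value `0` and the subtree for the value `1`; a leaf carries an output. -/
inductive DecisionTree (n : ℕ) : Type
  | leaf (b : Bool) : DecisionTree n
  | node (i : Fin n) (left right : DecisionTree n) : DecisionTree n

namespace DecisionTree

/-- The value of the tree on the input `x`: go left on `0`, right on `1`. -/
def eval {n : ℕ} : DecisionTree n → BoolFn n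
  | leaf b, _ => b
  | node i l r, x => if x i = true then r.eval x else l.eval x

/-- The size of a decision tree: its number of leaves. -/
def size {n : ℕ} : DecisionTree n → ℕ
  | leaf _ => 1
  | node _ l r => l.size + r.size

end DecisionTree

/-- The Boolean functions on `n` variables computed by a decision tree of size `s`. -/
def sizeDecisionTree (n s : ℕ) : Set (BoolFn n) :=
  {f | ∃ T : DecisionTree n, T.size = s ∧ T.eval = f}

/-! ## Branching programs -/

/-- What stands at a node of a branching program whose nodes are `Fin s`: either it is a sink with
an output, or it carries a variable and, for each value of it, the endpoint of an edge. -/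
inductive BPNode (n s : ℕ) : Type
  | sink (b : Bool) : BPNode n s
  | branch (i : Fin n) (child : Bool → Fin s) : BPNode n s

/-- Branching programs with exactly `s` nodes (sinks included) over `n` variables: a directed
acyclic graph with a distinguished root and exactly two sinks, one labelled `0` and one labelled
`1`. -/
structure BranchingProgram (n s : ℕ) where
  node : Fin s → BPNode n s
  root : Fin s
  existsUnique_sink : ∀ b : Bool, ∃! v : Fin s, node v = BPNode.sink b
  acyclic : ∀ v : Fin s, ¬ Relation.TransGen
    (fun u w => ∃ (i : Fin n) (child : Bool → Fin s) (b : Bool),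
      node u = BPNode.branch i child ∧ child b = w) v v

namespace BranchingProgram

/-- `P.Step x u w`: on the input `x` the computation moves from the internal node `u` to `w`. -/
def Step {n s : ℕ} (P : BranchingProgram n s) (x : Fin n → Bool) (u w : Fin s) : Prop :=
  ∃ (i : Fin n) (child : Bool → Fin s), P.node u = BPNode.branch i child ∧ child (x i) = w

/-- `P` computes `f`: on every input `x` the path from the root ends in the sink labelled `f x`. -/
def Computes {n s : ℕ} (P : BranchingProgram n s) (f : BoolFn n) : Prop :=
  ∀ x, ∃ v : Fin s, Relation.ReflTransGen (P.Step x) P.root v ∧ P.node v = BPNode.sink (f x)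

end BranchingProgram

/-- The Boolean functions on `n` variables computed by a branching program of size `s`. -/
def sizeBranchingProgram (n s : ℕ) : Set (BoolFn n) :=
  {f | ∃ P : BranchingProgram n s, P.Computes f}

/-! ## Testing algorithms -/

/-- Randomized adaptive query algorithms for Boolean functions on `n` variables. An algorithm may
stop and answer (`true` is "accept", `false` is "reject"), ask a membership query, ask an example
query, or make an internal uniform choice among `m + 1` possibilities. What it does next depends
on everything seen so far. -/
inductive QueryAlg (n : ℕ) : Type
  | output (b : Bool) : QueryAlg n
  | memQuery (x : Fin n → Bool) (next : Bool → QueryAlg n) : QueryAlg n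
  | exQuery (next : (Fin n → Bool) → QueryAlg n) : QueryAlg n
  | choose (m : ℕ) (next : Fin (m + 1) → QueryAlg n) : QueryAlg n

namespace QueryAlg

/-- The distribution of the answer when the membership oracle is that of `f` and the example
oracle draws independent strings from `D`. -/
noncomputable def run {n : ℕ} (f : BoolFn n) (D : PMF (Fin n → Bool)) : QueryAlg n → PMF Bool
  | output b => PMF.pure b
  | memQuery x next => run f D (next (f x))
  | exQuery next => D.bind fun x => run f D (next x)
  | choose m next => (PMF.uniformOfFintype (Fin (m + 1))).bind fun j => run f D (next j)

/-- The maximal number of queries, of both kinds together, on the function `f`, over all outcomes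
of the example queries and of the internal random choices. -/
def queries {n : ℕ} (f : BoolFn n) : QueryAlg n → ℕ
  | output _ => 0
  | memQuery x next => queries f (next (f x)) + 1
  | exQuery next => (Finset.univ.sup fun x => queries f (next x)) + 1
  | choose _ next => Finset.univ.sup fun j => queries f (next j)

end QueryAlg

/-- `Pr_{x ∈ D}[f(x) ≠ g(x)]`. -/
noncomputable def disagreement {n : ℕ} (D : PMF (Fin n → Bool)) (f g : BoolFn n) : ℝ :=
  ∑ x with f x ≠ g x, (D x).toReal

/-- `f` is `ε`-far from every function in `C` with respect to `D`. -/
def IsFar {n : ℕ} (C : Set (BoolFn n)) (D : PMF (Fin n → Bool)) (ε : ℝ) (f : BoolFn n) : Prop :=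
  ∀ g ∈ C, ε ≤ disagreement D f g

/-- With the example oracle for `D`, the algorithm `A` accepts every function in `C` with
probability at least `2/3` and rejects every function that is `ε`-far from `C` with respect to `D`
with probability at least `2/3`. -/
def TestsUnder {n : ℕ} (A : QueryAlg n) (C : Set (BoolFn n)) (ε : ℝ) (D : PMF (Fin n → Bool)) :
    Prop :=
  (∀ f ∈ C, 2 / 3 ≤ A.run f D true) ∧ (∀ f, IsFar C D ε f → 2 / 3 ≤ A.run f D false)

/-- `A` is an `ε`-tester for `C` in the uniform model. -/
def IsUniformTester {n : ℕ} (A : QueryAlg n) (C : Set (BoolFn n)) (ε : ℝ) : Prop :=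
  TestsUnder A C ε (PMF.uniformOfFintype (Fin n → Bool))

/-- `A` is a distribution-free `ε`-tester for `C`. -/
def IsDistributionFreeTester {n : ℕ} (A : QueryAlg n) (C : Set (BoolFn n)) (ε : ℝ) : Prop :=
  ∀ D : PMF (Fin n → Bool), TestsUnder A C ε D

/-- The shape `K · T · (log (T + 2)) ^ c` of a bound `O(T · poly(log T))`. -/
noncomputable def softO (K : ℝ) (c : ℕ) (T : ℝ) : ℝ :=
  K * (T * Real.log (T + 2) ^ c)

/-! ## A probabilistic query monad -/

/-! Both classes share the features collected in `ConciseFamily`: members depend on at most `s`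
variables, substituting variables or the constant 0 for variables stays in the class, and there are
few members. One tester serves every such family.

Colour the variables at random with `2 ^ R ≥ 4 * s ^ 2` colours. The relevant variables of a member
get distinct colours with probability at least 3/4, and then the tester accepts with certainty.
Relevant colour classes are found by comparing `f` at an example with `f` at the same example zeroed
outside the classes found so far. A difference is traced by binary search over hybrids to a single
class, which is stored with a string at which `f` is sensitive to it. A member allows at most `s`
discoveries; a batch of probes without a difference is evidence that `f` is `ε/4`-close to its
restriction to the found classes (`prob_search_le`).

For a member, `f` with only one found class left free is a literal. A class that survives the
literal test yields a variable `τ c` whose value at any `x` is, with high probability over a random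
point, the xor of two values of `f` (`literalTest_or_selfCorrect`). So, without knowing `τ`,
examples `x` become assignments `readOff st τ x` to the colours. Over the colours the class has at
most `2 ^ (14 * l * s)` members, `l = logParam s ε`, a bound free of `n`. Each pullback of such a
`G` along `readOff` lies in the original class, so a far `f` is far from all of them, and about `s *
l / ε` samples refute every `G` by a union bound (`prob_verify_le`). A sample costs about `s * l`
queries, whence `s ^ 2 / ε` up to logarithms.

Under the uniform distribution `readOff` of an example is a uniform assignment to the found colours,
because `τ` is injective there. Candidates can therefore be refuted with uniform colour assignments
at one query each, and only about `1 / ε` expensive samples are needed, to check that `f` on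
blown-up assignments agrees with the restricted `f` (`prob_verify_le_uniform`). This saves a factor
`s`. -/

/-- Randomized adaptive query procedures that return a value of type `α`. -/
inductive Proc (n : ℕ) (α : Type) : Type
  | ret (a : α) : Proc n α
  | memQuery (x : Fin n → Bool) (next : Bool → Proc n α) : Proc n α
  | exQuery (next : (Fin n → Bool) → Proc n α) : Proc n α
  | choose (m : ℕ) (next : Fin (m + 1) → Proc n α) : Proc n α

namespace Proc

variable {n : ℕ} {α β : Type}

/-- Sequential composition. -/
def andThen : Proc n α → (α → Proc n β) → Proc n β
  | ret a, q => q a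
  | memQuery x next, q => memQuery x fun b => (next b).andThen q
  | exQuery next, q => exQuery fun x => (next x).andThen q
  | choose m next, q => choose m fun j => (next j).andThen q

/-- The expected value of `φ` at the result. -/
noncomputable def expect (f : BoolFn n) (D : PMF (Fin n → Bool)) : Proc n α → (α → ℝ) → ℝ
  | ret a, φ => φ a
  | memQuery x next, φ => expect f D (next (f x)) φ
  | exQuery next, φ => ∑ x, (D x).toReal * expect f D (next x) φ
  | choose m next, φ => (∑ j, expect f D (next j) φ) / (m + 1)

/-- Every possible result satisfies `P`. -/
def Sure (f : BoolFn n) : Proc n α → (α → Prop) → Prop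
  | ret a, P => P a
  | memQuery x next, P => Sure f (next (f x)) P
  | exQuery next, P => ∀ x, Sure f (next x) P
  | choose _ next, P => ∀ j, Sure f (next j) P

/-- The maximal number of queries. -/
def cost (f : BoolFn n) : Proc n α → ℕ
  | ret _ => 0
  | memQuery x next => cost f (next (f x)) + 1
  | exQuery next => (Finset.univ.sup fun x => cost f (next x)) + 1
  | choose _ next => Finset.univ.sup fun j => cost f (next j)

/-- The testing algorithm that answers with the result of the procedure. -/
def toAlg : Proc n Bool → QueryAlg n
  | ret b => .output b
  | memQuery x next => .memQuery x fun b => (next b).toAlg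
  | exQuery next => .exQuery fun x => (next x).toAlg
  | choose m next => .choose m fun j => (next j).toAlg

variable (f : BoolFn n) (D : PMF (Fin n → Bool))

lemma queries_toAlg (p : Proc n Bool) : p.toAlg.queries f = p.cost f := by
  induction p with
  | ret a => rfl
  | memQuery x next ih => simp [toAlg, QueryAlg.queries, cost, ih]
  | exQuery next ih => simp [toAlg, QueryAlg.queries, cost, ih]
  | choose m next ih => simp [toAlg, QueryAlg.queries, cost, ih]

open Classical in
/-- The probability that the result satisfies `P`. -/
noncomputable def prob (p : Proc n α) (P : α → Prop) : ℝ :=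
  p.expect f D fun a => if P a then 1 else 0

/-- This carries the `PMF` semantics of testers over to real expectations, where all estimates are
made. -/
lemma run_toAlg (p : Proc n Bool) (b : Bool) :
    (p.toAlg.run f D b).toReal = p.prob f D (· = b) := by
  unfold prob
  induction p with
  | ret a =>
    by_cases h : a = b
    · simp [toAlg, QueryAlg.run, expect, h, PMF.pure_apply]
    · simp [toAlg, QueryAlg.run, expect, h, PMF.pure_apply, Ne.symm h]
  | memQuery x next ih => simp [toAlg, QueryAlg.run, expect, ih]
  | exQuery next ih =>
    simp only [toAlg, QueryAlg.run, expect, PMF.bind_apply, tsum_fintype]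
    rw [ENNReal.toReal_sum fun x _ => ENNReal.mul_ne_top (PMF.apply_ne_top _ _)
      (PMF.apply_ne_top _ _)]
    simp [ih]
  | choose m next ih =>
    simp only [toAlg, QueryAlg.run, expect, PMF.bind_apply, tsum_fintype]
    rw [ENNReal.toReal_sum fun x _ => ENNReal.mul_ne_top (PMF.apply_ne_top _ _)
      (PMF.apply_ne_top _ _)]
    simp only [ENNReal.toReal_mul, ih, Finset.sum_div]
    refine Finset.sum_congr rfl fun j _ => ?_
    have h : ((m : ENNReal) + 1).toReal = m + 1 := by
      rw [ENNReal.toReal_add (by simp) (by simp)]; simp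
    simp [h]
    ring

lemma sum_toReal_pmf : ∑ x, (D x).toReal = 1 := by
  have h := D.tsum_coe
  rw [tsum_fintype] at h
  rw [← ENNReal.toReal_sum fun x _ => PMF.apply_ne_top _ _, h, ENNReal.toReal_one]

variable {f D}

lemma expect_andThen (p : Proc n α) (q : α → Proc n β) (φ : β → ℝ) :
    (p.andThen q).expect f D φ = p.expect f D fun a => (q a).expect f D φ := by
  induction p with
  | ret a => rfl
  | memQuery x next ih => simp [andThen, expect, ih]
  | exQuery next ih => simp [andThen, expect, ih]
  | choose m next ih => simp [andThen, expect, ih]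

lemma expect_mono (p : Proc n α) {φ ψ : α → ℝ} (h : ∀ a, φ a ≤ ψ a) :
    p.expect f D φ ≤ p.expect f D ψ := by
  induction p with
  | ret a => exact h a
  | memQuery x next ih => exact ih _
  | exQuery next ih =>
    exact Finset.sum_le_sum fun x _ => mul_le_mul_of_nonneg_left (ih x) ENNReal.toReal_nonneg
  | choose m next ih =>
    exact div_le_div_of_nonneg_right (Finset.sum_le_sum fun x _ => ih x) (by positivity)

lemma expect_const (p : Proc n α) (c : ℝ) : p.expect f D (fun _ => c) = c := by
  induction p with
  | ret a => rfl
  | memQuery x next ih => exact ih _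
  | exQuery next ih => simp [expect, ih, ← Finset.sum_mul, sum_toReal_pmf]
  | choose m next ih => simp [expect, ih]; field_simp

lemma expect_add (p : Proc n α) (φ ψ : α → ℝ) :
    p.expect f D (fun a => φ a + ψ a) = p.expect f D φ + p.expect f D ψ := by
  induction p with
  | ret a => rfl
  | memQuery x next ih => exact ih _
  | exQuery next ih => simp [expect, ih, mul_add, Finset.sum_add_distrib]
  | choose m next ih => simp [expect, ih, Finset.sum_add_distrib, add_div]

lemma expect_mul_right (p : Proc n α) (φ : α → ℝ) (c : ℝ) :
    p.expect f D (fun a => φ a * c) = p.expect f D φ * c := by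
  induction p with
  | ret a => rfl
  | memQuery x next ih => exact ih _
  | exQuery next ih => simp only [expect, ih, Finset.sum_mul, mul_assoc]
  | choose m next ih => simp only [expect, ih, ← Finset.sum_mul]; ring

lemma expect_congr_of_sure {p : Proc n α} {P : α → Prop} (hp : p.Sure f P) {φ ψ : α → ℝ}
    (h : ∀ a, P a → φ a = ψ a) : p.expect f D φ = p.expect f D ψ := by
  induction p with
  | ret a => exact h a hp
  | memQuery x next ih => exact ih _ hp
  | exQuery next ih => exact Finset.sum_congr rfl fun x _ => by rw [ih x (hp x)]
  | choose m next ih =>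
    simp only [expect]; congr 1; exact Finset.sum_congr rfl fun x _ => ih x (hp x)

lemma sure_andThen {p : Proc n α} {q : α → Proc n β} {P : α → Prop} {Q : β → Prop}
    (hp : p.Sure f P) (hq : ∀ a, P a → (q a).Sure f Q) : (p.andThen q).Sure f Q := by
  induction p with
  | ret a => exact hq a hp
  | memQuery x next ih => exact ih _ hp
  | exQuery next ih => exact fun x => ih x (hp x)
  | choose m next ih => exact fun x => ih x (hp x)

lemma sure_true (p : Proc n α) : p.Sure f fun _ => True := by
  induction p with
  | ret a => trivial
  | memQuery x next ih => exact ih _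
  | exQuery next ih => exact fun x => ih x
  | choose m next ih => exact fun x => ih x

lemma cost_andThen_le {p : Proc n α} {q : α → Proc n β} {a b : ℕ} (hp : p.cost f ≤ a)
    (hq : ∀ x, (q x).cost f ≤ b) : (p.andThen q).cost f ≤ a + b := by
  refine le_trans ?_ (Nat.add_le_add_right hp b)
  clear hp
  induction p with
  | ret a => simpa [andThen, cost] using hq a
  | memQuery x next ih =>
    have := ih (f x)
    simp only [andThen, cost]; omega
  | exQuery next ih =>
    simp only [andThen, cost]
    have : (Finset.univ.sup fun x => cost f ((next x).andThen q)) ≤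
        (Finset.univ.sup fun x => cost f (next x)) + b :=
      Finset.sup_le fun x _ => (ih x).trans (Nat.add_le_add_right
        (Finset.le_sup (f := fun x => cost f (next x)) (Finset.mem_univ x)) b)
    omega
  | choose m next ih =>
    simp only [andThen, cost]
    exact Finset.sup_le fun x _ => (ih x).trans (Nat.add_le_add_right
        (Finset.le_sup (f := fun x => cost f (next x)) (Finset.mem_univ x)) b)

/-! ### Probabilities -/

lemma prob_nonneg (p : Proc n α) (P : α → Prop) : 0 ≤ p.prob f D P := by
  rw [← expect_const (f := f) (D := D) p 0]
  exact expect_mono p fun a => by split_ifs <;> norm_num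

lemma prob_mono (p : Proc n α) {P Q : α → Prop} (h : ∀ a, P a → Q a) :
    p.prob f D P ≤ p.prob f D Q :=
  expect_mono p fun a => by
    by_cases hP : P a
    · simp [hP, h a hP]
    · simp only [hP, if_false]; split_ifs <;> norm_num

lemma prob_le_one (p : Proc n α) (P : α → Prop) : p.prob f D P ≤ 1 := by
  rw [← expect_const (f := f) (D := D) p 1]
  exact expect_mono p fun a => by split_ifs <;> norm_num

lemma prob_eq_one_of_sure {p : Proc n α} {P : α → Prop} (h : p.Sure f P) :
    p.prob f D P = 1 := by
  rw [← expect_const (f := f) (D := D) p 1]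
  exact expect_congr_of_sure h fun a ha => by simp [ha]

lemma prob_false (p : Proc n α) : p.prob f D (fun _ => False) = 0 := by
  simpa [prob] using expect_const (f := f) (D := D) p 0

lemma prob_or_le (p : Proc n α) (P Q : α → Prop) :
    p.prob f D (fun a => P a ∨ Q a) ≤ p.prob f D P + p.prob f D Q := by
  unfold prob
  rw [← expect_add]
  exact expect_mono p fun a => by by_cases hP : P a <;> by_cases hQ : Q a <;> simp [hP, hQ]

lemma prob_not (p : Proc n α) (P : α → Prop) :
    p.prob f D (fun a => ¬ P a) = 1 - p.prob f D P := by
  rw [eq_sub_iff_add_eq, ← expect_const (f := f) (D := D) p 1]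
  unfold prob
  rw [← expect_add]
  congr 1
  ext a
  by_cases hP : P a <;> simp [hP]

lemma prob_exists_le {ι : Type*} (p : Proc n α) (s : Finset ι) (P : ι → α → Prop) {c : ℝ}
    (h : ∀ i ∈ s, p.prob f D (P i) ≤ c) :
    p.prob f D (fun a => ∃ i ∈ s, P i a) ≤ s.card * c := by
  classical
  induction s using Finset.induction_on with
  | empty => simp [prob_false]
  | insert i s hi ih =>
    have h1 : p.prob f D (fun a => ∃ j ∈ insert i s, P j a) ≤
        p.prob f D (P i) + p.prob f D (fun a => ∃ j ∈ s, P j a) := by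
      refine le_trans (prob_mono p ?_) (prob_or_le p _ _)
      simp only [Finset.mem_insert]
      rintro a ⟨j, rfl | hj, hP⟩
      · exact Or.inl hP
      · exact Or.inr ⟨j, hj, hP⟩
    have h2 := h i (Finset.mem_insert_self i s)
    have h3 := ih fun j hj => h j (Finset.mem_insert_of_mem hj)
    rw [Finset.card_insert_of_notMem hi]
    push_cast
    linarith

lemma prob_andThen (p : Proc n α) (q : α → Proc n β) (Q : β → Prop) :
    (p.andThen q).prob f D Q = p.expect f D fun a => (q a).prob f D Q :=
  expect_andThen p q _

/-- The two-stage union bound: charge the bad intermediate results `B` to the first stage, and bound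
the second stage from every other result. -/
lemma prob_andThen_le {p : Proc n α} {q : α → Proc n β} {Q : β → Prop} (B : α → Prop) {b : ℝ}
    (hb : 0 ≤ b) (h : ∀ a, ¬ B a → (q a).prob f D Q ≤ b) :
    (p.andThen q).prob f D Q ≤ p.prob f D B + b := by
  rw [prob_andThen, ← expect_const (f := f) (D := D) p b]
  unfold prob
  rw [← expect_add]
  refine expect_mono p fun a => ?_
  by_cases hB : B a
  · have := prob_le_one (f := f) (D := D) (q a) Q
    unfold prob at this
    simp only [hB, if_true]; linarith
  · have := h a hB
    unfold prob at this
    simpa [hB] using this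

lemma prob_andThen_le_of_forall {p : Proc n α} {q : α → Proc n β} {Q : β → Prop} {b : ℝ}
    (h : ∀ a, (q a).prob f D Q ≤ b) : (p.andThen q).prob f D Q ≤ b := by
  rw [prob_andThen, ← expect_const (f := f) (D := D) p b]
  exact expect_mono p h

/-! ### Basic procedures -/

/-- One membership query. -/
def mem (x : Fin n → Bool) : Proc n Bool := memQuery x ret

/-- One example query. -/
def ex : Proc n (Fin n → Bool) := exQuery ret

/-- A uniformly distributed element of a finite type. -/
noncomputable def unif (β : Type) [Fintype β] [Nonempty β] : Proc n β :=
  choose (Fintype.card β - 1) fun j =>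
    ret ((Fintype.equivFin β).symm (Fin.cast (Nat.sub_add_cancel Fintype.card_pos) j))

lemma prob_mem_andThen (x : Fin n → Bool) (q : Bool → Proc n β) (Q : β → Prop) :
    ((mem x).andThen q).prob f D Q = (q (f x)).prob f D Q := rfl

lemma sure_mem_andThen (x : Fin n → Bool) (q : Bool → Proc n β) (Q : β → Prop) :
    ((mem x).andThen q).Sure f Q ↔ (q (f x)).Sure f Q := Iff.rfl

lemma prob_ret (a : α) (P : α → Prop) [Decidable (P a)] :
    (ret a : Proc n α).prob f D P = if P a then 1 else 0 := by
  simp only [prob, expect]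
  congr

lemma prob_ex (P : (Fin n → Bool) → Prop) [DecidablePred P] :
    ex.prob f D P = ∑ x with P x, (D x).toReal := by
  simp only [prob, ex, expect, Finset.sum_filter]
  refine Finset.sum_congr rfl fun x _ => ?_
  by_cases h : P x <;> simp [h]

lemma expect_unif [Fintype β] [Nonempty β] (φ : β → ℝ) :
    (unif β).expect f D φ = (∑ b, φ b) / Fintype.card β := by
  have h1 : ((Fintype.card β - 1 : ℕ) : ℝ) + 1 = Fintype.card β := by
    have := Nat.sub_add_cancel (Fintype.card_pos (α := β))
    exact_mod_cast this
  simp only [unif, expect, h1]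
  congr 1
  exact Equiv.sum_comp ((finCongr (Nat.sub_add_cancel (Fintype.card_pos (α := β)))).trans
    (Fintype.equivFin β).symm) φ

lemma prob_unif [Fintype β] [Nonempty β] (P : β → Prop) [DecidablePred P] :
    (unif β).prob f D P = (Finset.univ.filter P).card / Fintype.card β := by
  classical
  rw [prob, expect_unif, Finset.natCast_card_filter]
  congr! 1
  exact Finset.sum_congr rfl fun b _ => by congr

lemma sure_unif [Fintype β] [Nonempty β] {P : β → Prop} (h : ∀ b, P b) :
    (unif β : Proc n β).Sure f P := fun _ => h _

lemma cost_ex : (ex : Proc n _).cost f ≤ 1 := by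
  simp only [ex, cost]
  have : (Finset.univ.sup fun _ : Fin n → Bool => (0 : ℕ)) ≤ 0 := Finset.sup_le fun _ _ => le_rfl
  omega

lemma cost_unif [Fintype β] [Nonempty β] : (unif β : Proc n β).cost f = 0 :=
  Nat.le_zero.1 (Finset.sup_le fun _ _ => le_rfl)

/-- `N` independent runs of `p`. -/
def repl (p : Proc n α) : ℕ → Proc n (List α)
  | 0 => ret []
  | N + 1 => p.andThen fun a => (repl p N).andThen fun l => ret (a :: l)

lemma sure_repl {p : Proc n α} {P : α → Prop} (h : p.Sure f P) (N : ℕ) :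
    (repl p N).Sure f fun l => l.length = N ∧ ∀ a ∈ l, P a := by
  induction N with
  | zero => simp [repl, Sure]
  | succ N ih =>
    refine sure_andThen h fun a ha => sure_andThen ih fun l hl => ?_
    simp only [Sure, List.length_cons, hl.1, List.mem_cons, forall_eq_or_imp, true_and]
    exact ⟨ha, hl.2⟩

/-- Independence of the runs; every amplification below rests on it. -/
lemma prob_repl (p : Proc n α) (P : α → Prop) (N : ℕ) :
    (repl p N).prob f D (fun l => ∀ a ∈ l, P a) = p.prob f D P ^ N := by
  induction N with
  | zero => simp [repl, prob, expect]
  | succ N ih =>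
    rw [pow_succ', repl, prob_andThen, ← ih]
    conv_rhs => rw [prob, ← expect_mul_right]
    congr 1
    ext a
    rw [prob_andThen]
    by_cases h : P a
    · simp only [prob, expect, h, if_true, one_mul]
      congr 1
      ext l
      by_cases hl : ∀ b ∈ l, P b
      · rw [if_pos hl, if_pos (List.forall_mem_cons.2 ⟨h, hl⟩)]
      · rw [if_neg hl, if_neg fun h' => hl (List.forall_mem_cons.1 h').2]
    · simp [h, prob, expect, expect_const]

lemma cost_repl {p : Proc n α} {a : ℕ} (h : p.cost f ≤ a) (N : ℕ) : (repl p N).cost f ≤ N * a := by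
  induction N with
  | zero => simp [repl, cost]
  | succ N ih =>
    have := cost_andThen_le (q := fun a => (repl p N).andThen fun l => ret (a :: l)) h
      fun x => cost_andThen_le (q := fun l => ret (x :: l)) ih (b := 0) fun l => le_rfl
    rw [repl]
    refine this.trans (le_of_eq ?_)
    ring

end Proc

/-! ## Fourier analysis on the cube -/

/-- Coordinatewise exclusive or. -/
def vxor {ι : Type*} (x y : ι → Bool) : ι → Bool := fun i => x i ^^ y i

/-- The sign `(-1)^b`. -/
noncomputable def sgn (b : Bool) : ℝ := if b then -1 else 1

/-- The character of the cube given by a set of coordinates. -/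
noncomputable def chi {n : ℕ} (S : Finset (Fin n)) (x : Fin n → Bool) : ℝ := ∏ i ∈ S, sgn (x i)

/-- The parity of the coordinates in a set. -/
def par {n : ℕ} (S : Finset (Fin n)) (x : Fin n → Bool) : Bool :=
  decide (Odd (S.filter fun i => x i = true).card)

lemma sgn_xor (a b : Bool) : sgn (a ^^ b) = sgn a * sgn b := by
  cases a <;> cases b <;> simp [sgn]

lemma sgn_mul_self (a : Bool) : sgn a * sgn a = 1 := by
  cases a <;> simp [sgn]

lemma sgn_injective : Function.Injective sgn := by
  intro a b h
  cases a <;> cases b <;> simp [sgn] at h ⊢ <;> norm_num at h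

section Fourier

variable {n : ℕ}

lemma sgn_par (S : Finset (Fin n)) (x : Fin n → Bool) : sgn (par S x) = chi S x := by
  have h : chi S x = (-1) ^ (S.filter fun i => x i = true).card := by
    simp only [chi, sgn, Finset.prod_ite, Finset.prod_const, one_pow, mul_one]
  rw [h]
  by_cases ho : Odd (S.filter fun i => x i = true).card
  · simp [sgn, par, ho, ho.neg_one_pow]
  · simp [sgn, par, ho, (Nat.not_odd_iff_even.1 ho).neg_one_pow]

lemma chi_vxor (S : Finset (Fin n)) (x y : Fin n → Bool) :
    chi S (vxor x y) = chi S x * chi S y := by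
  simp [chi, vxor, sgn_xor, Finset.prod_mul_distrib]

lemma par_vxor (S : Finset (Fin n)) (x y : Fin n → Bool) :
    par S (vxor x y) = (par S x ^^ par S y) :=
  sgn_injective (by rw [sgn_xor, sgn_par, sgn_par, sgn_par, chi_vxor])

lemma vxor_vxor_cancel {ι : Type*} (x y : ι → Bool) : vxor (vxor x y) y = x := by
  ext i; simp [vxor]

/-- Translation of the cube. -/
def xorEquiv {ι : Type*} (y : ι → Bool) : (ι → Bool) ≃ (ι → Bool) where
  toFun x := vxor x y
  invFun x := vxor x y
  left_inv x := vxor_vxor_cancel x y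
  right_inv x := vxor_vxor_cancel x y

/-- The sum over `S` factors into a product over coordinates, and a coordinate where `x` and `y`
differ contributes the factor 0. -/
lemma sum_chi (x y : Fin n → Bool) :
    ∑ S : Finset (Fin n), chi S x * chi S y =
      if x = y then (Fintype.card (Fin n → Bool) : ℝ) else 0 := by
  have h : ∑ S : Finset (Fin n), chi S x * chi S y = ∏ i, (1 + sgn (x i ^^ y i)) := by
    rw [Finset.prod_one_add, Finset.powerset_univ]
    exact Finset.sum_congr rfl fun S _ => by rw [← chi_vxor]; rfl
  rw [h]
  split_ifs with hxy
  · subst hxy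
    simp [sgn]
    norm_num
  · obtain ⟨i, hi⟩ := Function.ne_iff.1 hxy
    refine Finset.prod_eq_zero (Finset.mem_univ i) ?_
    have : (x i ^^ y i) = true := by cases h1 : x i <;> cases h2 : y i <;> simp_all
    simp [this, sgn]

/-- The unnormalized Fourier coefficient. -/
noncomputable def hat (G : (Fin n → Bool) → ℝ) (S : Finset (Fin n)) : ℝ := ∑ x, G x * chi S x

lemma parseval (G : (Fin n → Bool) → ℝ) :
    ∑ S, hat G S ^ 2 = Fintype.card (Fin n → Bool) * ∑ x, G x ^ 2 := by
  have h : ∀ S, hat G S ^ 2 = ∑ x, ∑ y, G x * G y * (chi S x * chi S y) := fun S => by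
    rw [sq, hat, Finset.sum_mul_sum]
    exact Finset.sum_congr rfl fun x _ => Finset.sum_congr rfl fun y _ => by ring
  simp only [h]
  rw [Finset.sum_comm, Finset.mul_sum]
  refine Finset.sum_congr rfl fun x _ => ?_
  rw [Finset.sum_comm]
  simp only [← Finset.mul_sum, sum_chi, mul_ite, mul_zero, Finset.sum_ite_eq, Finset.mem_univ,
    if_true]
  ring

/-- The autocorrelation of a function on the cube. -/
noncomputable def autocorr (G : (Fin n → Bool) → ℝ) (x : Fin n → Bool) : ℝ :=
  ∑ w, G (vxor w x) * G w

lemma hat_autocorr (G : (Fin n → Bool) → ℝ) (S : Finset (Fin n)) :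
    hat (autocorr G) S = hat G S ^ 2 := by
  simp only [hat, autocorr, sq, Finset.sum_mul]
  rw [Finset.sum_comm]
  simp only [Finset.mul_sum]
  rw [Finset.sum_comm, Finset.sum_comm]
  refine Finset.sum_congr rfl fun w _ => ?_
  rw [← Equiv.sum_comp (xorEquiv w)]
  refine Finset.sum_congr rfl fun y _ => ?_
  have h1 : vxor w (xorEquiv w y) = y := by
    ext i
    simp only [xorEquiv, vxor, Equiv.coe_fn_mk]
    cases w i <;> cases y i <;> rfl
  have h2 : chi S (xorEquiv w y) = chi S y * chi S w := chi_vxor S y w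
  rw [h1, h2]
  ring

/-- Parseval for the autocorrelation, whose transform is the square of that of `G`. -/
lemma sum_hat_pow_four (G : (Fin n → Bool) → ℝ) :
    ∑ S, (hat G S ^ 2) ^ 2 = Fintype.card (Fin n → Bool) * ∑ x, autocorr G x ^ 2 := by
  rw [← parseval]
  simp only [hat_autocorr]

end Fourier

/-! ## Testing for literals -/

section Literal

variable {n : ℕ}

/-- The distance count of `g` from the affine function `par S + b`. -/
def affineErr (g : BoolFn n) (S : Finset (Fin n)) (b : Bool) : Finset (Fin n → Bool) :=
  Finset.univ.filter fun x => g x ≠ (par S x ^^ b)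

lemma card_cube_pos : (0 : ℝ) < (Fintype.card (Fin n → Bool) : ℝ) := by
  exact_mod_cast Fintype.card_pos (α := Fin n → Bool)

/-- The hypothesis makes the fourth moment of the Fourier coefficients exceed `15/16 * N ^ 4`, while
their squares sum to `N ^ 2`; so one square exceeds `15/16 * N ^ 2`. As that coefficient is at most
`N` in absolute value, it exceeds `15/16 * N`, and the error count `(N - |hat G S|) / 2` is below `N
/ 32`. -/
lemma exists_affine_of_autocorr {g : BoolFn n}
    (h : 15 / 16 * (Fintype.card (Fin n → Bool) : ℝ) ^ 3 <
      ∑ x, autocorr (fun x => sgn (g x)) x ^ 2) :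
    ∃ S b, 32 * ((affineErr g S b).card : ℝ) ≤ Fintype.card (Fin n → Bool) := by
  set N : ℝ := (Fintype.card (Fin n → Bool) : ℝ) with hN
  have hN0 : 0 < N := card_cube_pos
  set G : (Fin n → Bool) → ℝ := fun x => sgn (g x) with hG
  have h4 := sum_hat_pow_four G
  have h2 := parseval G
  have hG2 : ∑ x, G x ^ 2 = N := by simp [hG, sq, sgn_mul_self, hN]
  rw [hG2] at h2
  rw [← hN] at h4 h2
  obtain ⟨S, hS⟩ : ∃ S, 15 / 16 * N ^ 2 < hat G S ^ 2 := by
    by_contra! hcon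
    have h5 : ∑ S, (hat G S ^ 2) ^ 2 ≤ ∑ S, 15 / 16 * N ^ 2 * hat G S ^ 2 :=
      Finset.sum_le_sum fun S _ => by
        rw [sq (hat G S ^ 2)]
        exact mul_le_mul_of_nonneg_right (hcon S) (sq_nonneg _)
    rw [← Finset.mul_sum, h2, h4] at h5
    have h6 := mul_lt_mul_of_pos_left h hN0
    nlinarith
  -- A signed coefficient is agreements minus disagreements with `par S ^^ b`.
  have key : ∀ b, sgn b * hat G S = N - 2 * (affineErr g S b).card := fun b => by
    have h7 : ∀ x, sgn b * (G x * chi S x) =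
        1 - 2 * (if g x ≠ (par S x ^^ b) then (1 : ℝ) else 0) := fun x => by
      rw [← sgn_par]
      simp only [hG]
      cases g x <;> cases par S x <;> cases b <;> simp [sgn] <;> norm_num
    rw [hat, Finset.mul_sum, Finset.sum_congr rfl fun x _ => h7 x, Finset.sum_sub_distrib,
      ← Finset.mul_sum, affineErr, Finset.natCast_card_filter]
    simp [hN]
  have hk1 := key false
  have hk2 := key true
  simp only [sgn, if_true, Bool.false_eq_true, if_false] at hk1 hk2
  have e1 : (0 : ℝ) ≤ (affineErr g S false).card := Nat.cast_nonneg _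
  have e2 : (0 : ℝ) ≤ (affineErr g S true).card := Nat.cast_nonneg _
  rcases le_total 0 (hat G S) with hp | hp
  · refine ⟨S, false, ?_⟩
    have : hat G S ≤ N := by linarith
    have : 15 / 16 * N < hat G S := by
      by_contra! hc
      nlinarith
    linarith
  · refine ⟨S, true, ?_⟩
    have : -hat G S ≤ N := by linarith
    have : 15 / 16 * N < -hat G S := by
      by_contra! hc
      nlinarith
    linarith

/-- A wrong difference needs an error at `w` or at its translate by `x`, and translation preserves
cardinality. The constant `b` cancels in the difference. -/
lemma card_selfCorrect_le (g : BoolFn n) (S : Finset (Fin n)) (b : Bool) (x : Fin n → Bool) :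
    (Finset.univ.filter fun w => (g (vxor w x) ^^ g w) ≠ par S x).card ≤
      2 * (affineErr g S b).card := by
  have h1 : (Finset.univ.filter fun w => (g (vxor w x) ^^ g w) ≠ par S x) ⊆
      (affineErr g S b).map (xorEquiv x).toEmbedding ∪ affineErr g S b := by
    intro w hw
    simp only [affineErr, Finset.mem_filter, Finset.mem_univ, true_and, Finset.mem_union,
      Finset.mem_map_equiv] at hw ⊢
    have h3 : (xorEquiv x).symm w = vxor w x := rfl
    rw [h3, par_vxor]
    by_contra! hc
    rw [hc.1, hc.2] at hw
    apply hw
    cases par S w <;> cases par S x <;> cases b <;> rfl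
  refine (Finset.card_le_card h1).trans ((Finset.card_union_le _ _).trans ?_)
  rw [Finset.card_map]
  omega

/-- Coordinatewise conjunction. -/
def vand (x y : Fin n → Bool) : Fin n → Bool := fun i => x i && y i

/-- Take distinct `i`, `j` in `S`, and shift `x` by `a` at `i` and `y` by `b` at `j`. Since `i ≠ j`,
the parity of the conjunction is affine in `(a, b)`, whereas `(par S x ^^ a) && (par S y ^^ b)`
contains the term `a * b`. So the identity fails for one of the four shifts of every pair, hence on
a quarter of all pairs. -/
lemma card_and_le {S : Finset (Fin n)} (hS : 1 < S.card) :
    4 * (Finset.univ.filter fun p : (Fin n → Bool) × (Fin n → Bool) =>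
      par S (vand p.1 p.2) = (par S p.1 && par S p.2)).card ≤
      3 * Fintype.card ((Fin n → Bool) × (Fin n → Bool)) := by
  classical
  obtain ⟨i, hi, j, hj, hij⟩ := Finset.one_lt_card.1 hS
  set Q : (Fin n → Bool) × (Fin n → Bool) → Prop :=
    fun p => par S (vand p.1 p.2) = (par S p.1 && par S p.2) with hQ
  let u (k : Fin n) (a : Bool) : Fin n → Bool := fun l => decide (l = k) && a
  let e (a b : Bool) := (xorEquiv (u i a)).prodCongr (xorEquiv (u j b))
  have hu : ∀ k ∈ S, ∀ a, par S (u k a) = a := by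
    intro k hk a
    cases a
    · simp [par, u]
    · simp [par, u, Finset.filter_eq', hk]
  have key : ∀ p, ∃ a b, ¬ Q (e a b p) := by
    rintro ⟨x, y⟩
    by_contra! hc
    have hv : ∀ a b, vand (vxor x (u i a)) (vxor y (u j b)) =
        vxor (vxor (vand x y) (vand x (u j b))) (vand (u i a) y) := by
      intro a b
      ext l
      by_cases h1 : l = i
      · simp only [vand, vxor, u, decide_true, h1, Bool.true_and]
        simp only [hij, decide_false, Bool.false_and, Bool.xor_false, Bool.and_false]
        cases x i <;> cases y i <;> cases a <;> rfl
      · simp only [vand, vxor, u, h1, decide_false, Bool.false_and, Bool.xor_false]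
        cases x l <;> cases y l <;> cases decide (l = j) <;> cases b <;> rfl
    have h4 : ∀ a b, par S (vand (vxor x (u i a)) (vxor y (u j b))) =
        ((par S x ^^ a) && (par S y ^^ b)) := fun a b => by
      have := hc a b
      simp only [hQ, e, Equiv.prodCongr_apply, Prod.map, xorEquiv, Equiv.coe_fn_mk, par_vxor,
        hu i hi, hu j hj] at this
      exact this
    simp only [hv, par_vxor] at h4
    have z1 : vand x (u j false) = fun _ => false := by ext; simp [vand, u]
    have z2 : vand (u i false) y = fun _ => false := by ext; simp [vand, u]
    have z3 : par S (fun _ => false) = false := by simp [par]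
    have a1 := h4 false false
    have a2 := h4 true false
    have a3 := h4 false true
    have a4 := h4 true true
    simp only [z1, z2, z3] at a1 a2 a3 a4
    revert a1 a2 a3 a4
    generalize par S (vand x y) = A
    generalize par S (vand x (u j true)) = B
    generalize par S (vand (u i true) y) = C
    generalize par S x = E
    generalize par S y = F
    revert A B C E F
    decide
  -- Four translates of the failure set cover everything.
  have hcount : (Finset.univ : Finset ((Fin n → Bool) × (Fin n → Bool))) ⊆
      (Finset.univ : Finset (Bool × Bool)).biUnion fun ab =>
        (Finset.univ.filter fun p => ¬ Q p).map (e ab.1 ab.2).symm.toEmbedding := by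
    intro p _
    obtain ⟨a, b, h⟩ := key p
    simp only [Finset.mem_biUnion, Finset.mem_univ, true_and, Finset.mem_map_equiv,
      Finset.mem_filter, Equiv.symm_symm]
    exact ⟨(a, b), h⟩
  have h5 := (Finset.card_le_card hcount).trans Finset.card_biUnion_le
  simp only [Finset.card_map, Finset.sum_const, Finset.card_univ, Fintype.card_prod,
    Fintype.card_bool, smul_eq_mul] at h5
  have h6 := Finset.card_filter_add_card_filter_not (s := Finset.univ) Q
  have h7 : (Finset.univ.filter fun p : (Fin n → Bool) × (Fin n → Bool) =>
      par S (vand p.1 p.2) = (par S p.1 && par S p.2)).card = (Finset.univ.filter Q).card := by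
    congr!
  simp only [Finset.card_univ, Fintype.card_prod] at h6 ⊢
  omega

end Literal

/-! ### Soundness and completeness of the literal test. -/

namespace Proc

variable {n : ℕ} {f : BoolFn n} {D : PMF (Fin n → Bool)}

/-- Run two procedures and return the conjunction of their results. -/
def both (p r : Proc n Bool) : Proc n Bool :=
  p.andThen fun a => r.andThen fun b => ret (a && b)

lemma prob_both_le_left (p r : Proc n Bool) :
    (both p r).prob f D (· = true) ≤ p.prob f D (· = true) := by
  rw [← add_zero (p.prob f D (· = true))]
  refine prob_andThen_le _ le_rfl fun a ha => prob_andThen_le_of_forall fun b => ?_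
  rw [prob_ret]
  simp [ha]

lemma prob_both_le_right (p r : Proc n Bool) :
    (both p r).prob f D (· = true) ≤ r.prob f D (· = true) := by
  refine prob_andThen_le_of_forall fun a => ?_
  rw [← add_zero (r.prob f D (· = true))]
  refine prob_andThen_le _ le_rfl fun b hb => ?_
  rw [prob_ret]
  simp [hb]

lemma sure_both {p r : Proc n Bool} (hp : p.Sure f (· = true)) (hr : r.Sure f (· = true)) :
    (both p r).Sure f (· = true) :=
  sure_andThen hp fun a ha => sure_andThen hr fun b hb => by
    subst ha; subst hb; rfl

lemma cost_both_le {p r : Proc n Bool} {a b : ℕ} (hp : p.cost f ≤ a) (hr : r.cost f ≤ b) :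
    (both p r).cost f ≤ a + b :=
  cost_andThen_le hp fun _ => cost_andThen_le (b := 0) hr fun _ => le_rfl

/-- The difference of the values of `f` at `q (w + x)` and `q w`. -/
def diffQuery (q : (Fin n → Bool) → Fin n → Bool) (w x : Fin n → Bool) : Proc n Bool :=
  (mem (q (vxor w x))).andThen fun a => (mem (q w)).andThen fun b => ret (a ^^ b)

lemma prob_diffQuery_andThen {β : Type} (q : (Fin n → Bool) → Fin n → Bool) (w x : Fin n → Bool)
    (r : Bool → Proc n β) (Q : β → Prop) :
    ((diffQuery q w x).andThen r).prob f D Q = (r (f (q (vxor w x)) ^^ f (q w))).prob f D Q := rfl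

/-- Is the difference in direction `x` the same at two random points? -/
noncomputable def diffTest (q : (Fin n → Bool) → Fin n → Bool) : Proc n Bool :=
  (unif ((Fin n → Bool) × (Fin n → Bool) × (Fin n → Bool))).andThen fun p =>
    (diffQuery q p.2.1 p.1).andThen fun a =>
      (diffQuery q p.2.2 p.1).andThen fun b => ret (a == b)

/-- Does the difference behave multiplicatively under conjunction? -/
noncomputable def andTest (q : (Fin n → Bool) → Fin n → Bool) : Proc n Bool :=
  (unif ((Fin n → Bool) × (Fin n → Bool))).andThen fun p => (unif (Fin n → Bool)).andThen fun w =>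
    (diffQuery q w (vand p.1 p.2)).andThen fun a => (diffQuery q w p.1).andThen fun b =>
      (diffQuery q w p.2).andThen fun c => ret (a == (b && c))

/-- Do antipodal points have different values? -/
noncomputable def antipodalTest (q : (Fin n → Bool) → Fin n → Bool) : Proc n Bool :=
  (unif (Fin n → Bool)).andThen fun w => diffQuery q w fun _ => true

/-- One round of the test whether `f ∘ q` is a literal. -/
noncomputable def literalTest (q : (Fin n → Bool) → Fin n → Bool) : Proc n Bool :=
  both (diffTest q) (both (andTest q) (antipodalTest q))

lemma cost_literalTest (q : (Fin n → Bool) → Fin n → Bool) : (literalTest q).cost f ≤ 12 := by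
  have h : ∀ w x, (diffQuery q w x).cost f ≤ 2 := fun w x => le_rfl
  refine cost_both_le (a := 4) (b := 8) ?_ (cost_both_le (a := 6) (b := 2) ?_ ?_)
  · exact cost_andThen_le (a := 0) (b := 4) cost_unif.le fun _ =>
      cost_andThen_le (a := 2) (b := 2) (h _ _) fun _ =>
      cost_andThen_le (a := 2) (b := 0) (h _ _) fun _ => le_rfl
  · exact cost_andThen_le (a := 0) (b := 6) cost_unif.le fun _ =>
      cost_andThen_le (a := 0) (b := 6) cost_unif.le fun _ =>
      cost_andThen_le (a := 2) (b := 4) (h _ _) fun _ =>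
      cost_andThen_le (a := 2) (b := 2) (h _ _) fun _ =>
      cost_andThen_le (a := 2) (b := 0) (h _ _) fun _ => le_rfl
  · exact cost_andThen_le (a := 0) (b := 2) cost_unif.le fun _ => h _ _

lemma sure_literalTest {q : (Fin n → Bool) → Fin n → Bool} {i : Fin n} {b : Bool}
    (h : ∀ x, f (q x) = (x i ^^ b)) : (literalTest q).Sure f (· = true) := by
  have hd : ∀ w x, (f (q (vxor w x)) ^^ f (q w)) = x i := fun w x => by
    rw [h, h, vxor]
    cases w i <;> cases x i <;> cases b <;> rfl
  refine sure_both ?_ (sure_both ?_ ?_)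
  · refine sure_andThen (sure_true _) fun p _ => ?_
    change ((f (q (vxor p.2.1 p.1)) ^^ f (q p.2.1)) == (f (q (vxor p.2.2 p.1)) ^^ f (q p.2.2)))
      = true
    simp only [hd, beq_self_eq_true]
  · refine sure_andThen (sure_true _) fun p _ => sure_andThen (sure_true _) fun w _ => ?_
    change ((f (q (vxor w (vand p.1 p.2))) ^^ f (q w)) ==
      ((f (q (vxor w p.1)) ^^ f (q w)) && (f (q (vxor w p.2)) ^^ f (q w)))) = true
    simp only [hd, vand, beq_self_eq_true]
  · refine sure_andThen (sure_true _) fun w _ => ?_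
    change (f (q (vxor w fun _ => true)) ^^ f (q w)) = true
    rw [hd]

/-- Acceptance has indicator `1/2 + 1/2 * (product of four signs)`, so probability above 31/32 means
mean product above 15/16. For a fixed direction the two base points are independent, which makes the
sum of these products a squared autocorrelation. -/
lemma exists_affine_of_diffTest {q : (Fin n → Bool) → Fin n → Bool}
    (h : 31 / 32 < (diffTest q).prob f D (· = true)) :
    ∃ S b, 32 * ((affineErr (fun x => f (q x)) S b).card : ℝ) ≤
      (Fintype.card (Fin n → Bool) : ℝ) := by
  apply exists_affine_of_autocorr
  set N : ℝ := (Fintype.card (Fin n → Bool) : ℝ) with hN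
  have hN0 : 0 < N := card_cube_pos
  have h1 : (diffTest q).prob f D (· = true) =
      (∑ p : (Fin n → Bool) × (Fin n → Bool) × (Fin n → Bool),
        ((1 : ℝ) / 2 + 1 / 2 * (sgn (f (q (vxor p.2.1 p.1))) * sgn (f (q p.2.1)) *
          (sgn (f (q (vxor p.2.2 p.1))) * sgn (f (q p.2.2)))))) / N ^ 3 := by
    rw [diffTest, prob_andThen, expect_unif]
    have h2 : (Fintype.card ((Fin n → Bool) × (Fin n → Bool) × (Fin n → Bool)) : ℝ) = N ^ 3 := by
      simp only [Fintype.card_prod, Nat.cast_mul, ← hN]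
      ring
    rw [h2]
    congr 1
    refine Finset.sum_congr rfl fun p _ => ?_
    rw [prob_diffQuery_andThen, prob_diffQuery_andThen, prob_ret]
    cases f (q (vxor p.2.1 p.1)) <;> cases f (q p.2.1) <;> cases f (q (vxor p.2.2 p.1)) <;>
      cases f (q p.2.2) <;> norm_num [sgn]
  have h3 : ∑ x, autocorr (fun x => sgn (f (q x))) x ^ 2 =
      ∑ p : (Fin n → Bool) × (Fin n → Bool) × (Fin n → Bool),
        (sgn (f (q (vxor p.2.1 p.1))) * sgn (f (q p.2.1)) *
          (sgn (f (q (vxor p.2.2 p.1))) * sgn (f (q p.2.2)))) := by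
    rw [Fintype.sum_prod_type]
    refine Finset.sum_congr rfl fun x _ => ?_
    rw [Fintype.sum_prod_type, sq, autocorr, Finset.sum_mul_sum]
  rw [h1, Finset.sum_add_distrib, ← Finset.mul_sum, ← h3, lt_div_iff₀ (by positivity)] at h
  simp only [Finset.sum_const, Finset.card_univ, Fintype.card_prod, nsmul_eq_mul, Nat.cast_mul,
    ← hN] at h
  nlinarith

/-- Self-correction: the difference in a fixed direction is rarely wrong. -/
lemma prob_selfCorrect_le {q : (Fin n → Bool) → Fin n → Bool} {S : Finset (Fin n)} {b : Bool}
    (h : 32 * ((affineErr (fun x => f (q x)) S b).card : ℝ) ≤ (Fintype.card (Fin n → Bool) : ℝ))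
    (x : Fin n → Bool) :
    (unif (Fin n → Bool)).prob f D (fun w => (f (q (vxor w x)) ^^ f (q w)) ≠ par S x) ≤ 1 / 16 := by
  rw [prob_unif, div_le_iff₀ card_cube_pos]
  have h1 := card_selfCorrect_le (fun x => f (q x)) S b x
  have h2 : ((Finset.univ.filter fun w => (f (q (vxor w x)) ^^ f (q w)) ≠ par S x).card : ℝ) ≤
      2 * (affineErr (fun x => f (q x)) S b).card := by exact_mod_cast h1
  linarith

/-- The parity itself passes on at most 3/4 of the pairs, and each of the three self-corrected
differences is wrong with probability at most 1/16. -/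
lemma prob_andTest_le {q : (Fin n → Bool) → Fin n → Bool} {S : Finset (Fin n)} {b : Bool}
    (h : 32 * ((affineErr (fun x => f (q x)) S b).card : ℝ) ≤ (Fintype.card (Fin n → Bool) : ℝ))
    (hS : 1 < S.card) : (andTest q).prob f D (· = true) ≤ 15 / 16 := by
  have h1 : (unif ((Fin n → Bool) × (Fin n → Bool))).prob f D (fun p =>
      par S (vand p.1 p.2) = (par S p.1 && par S p.2)) ≤ 3 / 4 := by
    rw [prob_unif, div_le_iff₀ (by exact_mod_cast Fintype.card_pos)]
    have h2 : 4 * ((Finset.univ.filter fun p : (Fin n → Bool) × (Fin n → Bool) =>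
      par S (vand p.1 p.2) = (par S p.1 && par S p.2)).card : ℝ) ≤
      3 * (Fintype.card ((Fin n → Bool) × (Fin n → Bool)) : ℝ) := by
      exact_mod_cast card_and_le hS
    linarith
  have h3 := prob_andThen_le (f := f) (D := D) (p := unif ((Fin n → Bool) × (Fin n → Bool)))
    (q := fun p => (unif (Fin n → Bool)).andThen fun w =>
    (diffQuery q w (vand p.1 p.2)).andThen fun a => (diffQuery q w p.1).andThen fun b =>
      (diffQuery q w p.2).andThen fun c => ret (a == (b && c))) (Q := (· = true))
    (fun p => par S (vand p.1 p.2) = (par S p.1 && par S p.2)) (b := 3 / 16) (by norm_num) ?_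
  · rw [andTest]
    linarith
  · rintro ⟨x, y⟩ hxy
    have e := fun z => prob_selfCorrect_le (D := D) h z
    have h4 : (unif (Fin n → Bool)).prob f D (fun w =>
        (f (q (vxor w (vand x y))) ^^ f (q w)) ≠ par S (vand x y) ∨
        ((f (q (vxor w x)) ^^ f (q w)) ≠ par S x ∨
        (f (q (vxor w y)) ^^ f (q w)) ≠ par S y)) ≤ 3 / 16 := by
      refine (prob_or_le _ _ _).trans ?_
      have := prob_or_le (f := f) (D := D) (unif (Fin n → Bool))
        (fun w => (f (q (vxor w x)) ^^ f (q w)) ≠ par S x)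
        (fun w => (f (q (vxor w y)) ^^ f (q w)) ≠ par S y)
      have e1 := e x
      have e2 := e y
      have e3 := e (vand x y)
      linarith
    rw [← add_zero (3 / 16 : ℝ)]
    refine (prob_andThen_le _ le_rfl fun w hw => ?_).trans (add_le_add_left h4 0)
    push Not at hw
    rw [prob_diffQuery_andThen, prob_diffQuery_andThen, prob_diffQuery_andThen, prob_ret,
      hw.1, hw.2.1, hw.2.2, if_neg]
    simpa using hxy

/-- The empty parity has difference 0 in every direction, while acceptance demands difference 1. -/
lemma prob_antipodalTest_le {q : (Fin n → Bool) → Fin n → Bool} {b : Bool}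
    (h : 32 * ((affineErr (fun x => f (q x)) ∅ b).card : ℝ) ≤ (Fintype.card (Fin n → Bool) : ℝ)) :
    (antipodalTest q).prob f D (· = true) ≤ 1 / 16 := by
  have h1 := prob_selfCorrect_le (D := D) h fun _ => true
  rw [← add_zero (1 / 16 : ℝ)]
  refine (prob_andThen_le _ le_rfl fun w hw => ?_).trans (add_le_add_left h1 0)
  push Not at hw
  rw [diffQuery, prob_mem_andThen, prob_mem_andThen, prob_ret, hw]
  simp [par]

/-- Either a round of the literal test fails with constant probability, or there is a variable
whose value the self-corrector computes. -/
theorem literalTest_or_selfCorrect (q : (Fin n → Bool) → Fin n → Bool) :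
    (literalTest q).prob f D (· = true) ≤ 31 / 32 ∨
    ∃ i : Fin n, (∀ x, (unif (Fin n → Bool)).prob f D
      (fun w => (f (q (vxor w x)) ^^ f (q w)) ≠ x i) ≤ 1 / 16) := by
  by_cases h : (diffTest q).prob f D (· = true) ≤ 31 / 32
  · exact Or.inl ((prob_both_le_left _ _).trans h)
  obtain ⟨S, b, hSb⟩ := exists_affine_of_diffTest (not_le.1 h)
  -- Near-constants fail the antipodal test, parities of two or more variables fail the conjunction
  -- test, and a single variable remains.
  rcases lt_trichotomy S.card 1 with hS | hS | hS
  · left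
    have : S = ∅ := by rw [← Finset.card_eq_zero]; omega
    subst this
    refine (prob_both_le_right _ _).trans ((prob_both_le_right _ _).trans ?_)
    exact (prob_antipodalTest_le hSb).trans (by norm_num)
  · right
    obtain ⟨i, rfl⟩ := Finset.card_eq_one.1 hS
    refine ⟨i, fun x => ?_⟩
    convert prob_selfCorrect_le hSb x using 4
    cases hx : x i <;> simp [par, Finset.filter_singleton, hx]
  · left
    refine (prob_both_le_right _ _).trans ((prob_both_le_left _ _).trans ?_)
    exact (prob_andTest_le hSb hS).trans (by norm_num)

end Proc

/-! ## The tester -/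

namespace Proc

variable {n : ℕ} {α β : Type} {f : BoolFn n} {D : PMF (Fin n → Bool)}

lemma Sure.mono {p : Proc n α} {P Q : α → Prop} (hp : p.Sure f P) (h : ∀ a, P a → Q a) :
    p.Sure f Q := by
  induction p with
  | ret a => exact h a hp
  | memQuery x next ih => exact ih _ hp
  | exQuery next ih => exact fun x => ih x (hp x)
  | choose m next ih => exact fun x => ih x (hp x)

lemma prob_andThen_of_sure_eq {p : Proc n α} {a : α} (h : p.Sure f (· = a)) (q : α → Proc n β)
    (Q : β → Prop) : (p.andThen q).prob f D Q = (q a).prob f D Q := by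
  rw [prob_andThen, expect_congr_of_sure (ψ := fun _ => (q a).prob f D Q) h, expect_const]
  rintro b rfl
  rfl

/-- Collect the answers of a family of procedures, with `false` outside the list. -/
def collect {κ : Type} [DecidableEq κ] (a : κ → Proc n Bool) : List κ → Proc n (κ → Bool)
  | [] => ret fun _ => false
  | c :: l => (a c).andThen fun b => (collect a l).andThen fun y => ret (Function.update y c b)

lemma sure_collect {κ : Type} [DecidableEq κ] {a : κ → Proc n Bool} {v : κ → Bool}
    (h : ∀ c, (a c).Sure f (· = v c)) (l : List κ) :
    (collect a l).Sure f (· = fun c => decide (c ∈ l) && v c) := by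
  induction l with
  | nil => simp [collect, Sure]
  | cons c l ih =>
    refine sure_andThen (h c) fun b hb => sure_andThen ih fun y hy => ?_
    change Function.update y c b = _
    subst hb hy
    ext d
    by_cases hd : d = c
    · subst hd; simp
    · simp [hd]

lemma cost_collect_le {κ : Type} [DecidableEq κ] {a : κ → Proc n Bool} {k : ℕ}
    (h : ∀ c, (a c).cost f ≤ k) (l : List κ) : (collect a l).cost f ≤ l.length * k := by
  induction l with
  | nil => simp [collect, cost]
  | cons c l ih =>
    refine (cost_andThen_le (h c) fun b => cost_andThen_le (b := 0) ih fun y => le_rfl).trans ?_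
    rw [List.length_cons]
    linarith

/-- The conjunction of the results of a family of procedures. -/
def allOf {κ : Type} (a : κ → Proc n Bool) : List κ → Proc n Bool
  | [] => ret true
  | c :: l => both (a c) (allOf a l)

lemma sure_allOf {κ : Type} {a : κ → Proc n Bool} {l : List κ}
    (h : ∀ c ∈ l, (a c).Sure f (· = true)) : (allOf a l).Sure f (· = true) := by
  induction l with
  | nil => rfl
  | cons c l ih =>
    exact sure_both (h c (by simp)) (ih fun d hd => h d (by simp [hd]))

lemma prob_allOf_le {κ : Type} (a : κ → Proc n Bool) {l : List κ} {c : κ} (hc : c ∈ l) :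
    (allOf a l).prob f D (· = true) ≤ (a c).prob f D (· = true) := by
  induction l with
  | nil => simp at hc
  | cons d l ih =>
    rcases List.mem_cons.1 hc with rfl | hc
    · exact prob_both_le_left _ _
    · exact (prob_both_le_right _ _).trans (ih hc)

lemma cost_allOf_le {κ : Type} {a : κ → Proc n Bool} {k : ℕ}
    (h : ∀ c, (a c).cost f ≤ k) (l : List κ) : (allOf a l).cost f ≤ l.length * k := by
  induction l with
  | nil => simp [allOf, cost]
  | cons c l ih =>
    refine (cost_both_le (h c) ih).trans ?_
    rw [List.length_cons]
    linarith

/-- Binary search along a sequence of points for a place where the value changes. -/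
def bisect (q : ℕ → Fin n → Bool) : ℕ → ℕ → Bool → Proc n ℕ
  | 0, a, _ => ret a
  | d + 1, a, b => (mem (q (a + 2 ^ d))).andThen fun b' =>
      if b' = b then bisect q d (a + 2 ^ d) b else bisect q d a b

/-- The invariant is that `f` takes different values at the two ends of the current interval of
length `2 ^ d`; the half that is kept inherits it. -/
lemma sure_bisect (q : ℕ → Fin n → Bool) (d a : ℕ) (h : f (q a) ≠ f (q (a + 2 ^ d))) :
    (bisect q d a (f (q a))).Sure f fun k => k < a + 2 ^ d ∧ f (q k) ≠ f (q (k + 1)) := by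
  induction d generalizing a with
  | zero => exact ⟨by simp, by simpa using h⟩
  | succ d ih =>
    rw [bisect, sure_mem_andThen]
    split_ifs with h1
    · rw [← h1]
      refine (ih (a + 2 ^ d) ?_).mono fun k hk => ⟨?_, hk.2⟩
      · rw [h1, add_assoc, ← two_mul, ← pow_succ']
        exact h
      · rw [pow_succ]; omega
    · refine (ih a (Ne.symm h1)).mono fun k hk => ⟨?_, hk.2⟩
      rw [pow_succ]; omega

lemma cost_bisect_le (q : ℕ → Fin n → Bool) (d a : ℕ) (b : Bool) : (bisect q d a b).cost f ≤ d := by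
  induction d generalizing a with
  | zero => exact le_rfl
  | succ d ih =>
    refine (cost_andThen_le (a := 1) (b := d) le_rfl fun b' => ?_).trans (by omega)
    split_ifs
    · exact ih _
    · exact ih _

end Proc

/-! ### Random colourings, relevant colour classes, and the tester built on them. -/

section Tester

variable {n R : ℕ}

/-- A colour class with a string is recorded when that string witnesses that `f` depends on the
class. -/
abbrev Found (n R : ℕ) : Type := Fin (2 ^ R) → Option (Fin n → Bool)

variable (π : Fin n → Fin (2 ^ R)) (st : Found n R)

/-- The colours that have been found. -/
def Found.colors : Finset (Fin (2 ^ R)) := Finset.univ.filter fun c => (st c).isSome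

/-- Set all variables outside the found classes to `0`. -/
def restrictTo (x : Fin n → Bool) : Fin n → Bool := fun i => (st (π i)).isSome && x i

/-- Keep the found classes and the classes of colour less than `a`. -/
def hybrid (x : Fin n → Bool) (a : ℕ) : Fin n → Bool :=
  fun i => ((st (π i)).isSome || decide ((π i : ℕ) < a)) && x i

/-- Replace the variables of one colour class. -/
def splice (c : Fin (2 ^ R)) (v x : Fin n → Bool) : Fin n → Bool :=
  fun i => if π i = c then x i else v i

/-- Give all variables of a found class a common value, and the other variables the value `0`. -/
def blowUp (y : Fin (2 ^ R) → Bool) : Fin n → Bool := fun i => (st (π i)).isSome && y (π i)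

/-- Set the colours not found to `0`. -/
def Found.mask (y : Fin (2 ^ R) → Bool) : Fin (2 ^ R) → Bool := fun c => (st c).isSome && y c

/-- The recorded witness. -/
def Found.witness (c : Fin (2 ^ R)) : Fin n → Bool := (st c).getD fun _ => false

open Proc

/-- Draw an example and compare the values of `f` there and at its restriction. -/
def probe : Proc n ((Fin n → Bool) × Bool × Bool) :=
  ex.andThen fun x => (mem (restrictTo π st x)).andThen fun a => (mem x).andThen fun b =>
    ret (x, a, b)

/-- Search for relevant colour classes, at most `N` times. -/
def search (π : Fin n → Fin (2 ^ R)) (m : ℕ) : ℕ → Found n R → Proc n (Option (Found n R))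
  | 0, _ => ret none
  | N + 1, st => (repl (probe π st) m).andThen fun l =>
    match l.find? fun t => t.2.1 != t.2.2 with
    | none => ret (some st)
    | some t => (bisect (hybrid π st t.1) R 0 t.2.1).andThen fun a =>
      if h : a < 2 ^ R then
        search π m N (Function.update st ⟨a, h⟩ (some (hybrid π st t.1 (a + 1))))
      else ret none

/-- Repeated literal test for one found class. -/
noncomputable def classTest (t : ℕ) (c : Fin (2 ^ R)) : Proc n Bool :=
  (repl (literalTest (splice π c (st.witness c))) t).andThen fun l => ret (l.all id)

/-- One attempt to compute the values of the relevant variables at `x`. -/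
noncomputable def extract (x : Fin n → Bool) : Proc n (Fin (2 ^ R) → Bool) :=
  (unif (Fin n → Bool)).andThen fun w =>
    collect (fun c => diffQuery (splice π c (st.witness c)) w x) st.colors.toList

/-- Draw an example, compute the values of the relevant variables, and check that these determine
the value of the restricted function. -/
noncomputable def sample (T : ℕ) : Proc n (Bool × (Fin (2 ^ R) → Bool) × Bool) :=
  ex.andThen fun x => (mem (restrictTo π st x)).andThen fun a =>
    (repl (extract π st x) (T + 1)).andThen fun l =>
      (mem (blowUp π st (l.headD fun _ => false))).andThen fun b =>
        ret (decide (∀ y ∈ l, y = l.headD fun _ => false) && (a == b),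
          st.mask (l.headD fun _ => false), a)

/-- Draw a uniform assignment to the found classes. -/
noncomputable def cubeSample : Proc n ((Fin (2 ^ R) → Bool) × Bool) :=
  (unif (Fin (2 ^ R) → Bool)).andThen fun y => (mem (blowUp π st y)).andThen fun b =>
    ret (st.mask y, b)

open Classical in
/-- The part of the tester after the search. -/
noncomputable def verify (H : Set (BoolFn (2 ^ R))) (t T M₁ M₂ : ℕ) : Proc n Bool :=
  (allOf (classTest π st t) st.colors.toList).andThen fun b =>
    (repl (sample π st T) M₁).andThen fun l₁ => (repl (cubeSample π st) M₂).andThen fun l₂ =>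
      ret (b && decide (∃ G ∈ H, (∀ e ∈ l₁, e.1 = true ∧ G e.2.1 = e.2.2) ∧ ∀ e ∈ l₂, G e.1 = e.2))

/-- The tester for a fixed colouring. -/
noncomputable def testColored (H : Set (BoolFn (2 ^ R))) (s m t T M₁ M₂ : ℕ) : Proc n Bool :=
  (search π m (s + 1) fun _ => none).andThen fun o =>
    match o with
    | none => ret false
    | some st => if st.colors.card ≤ s then verify π st H t T M₁ M₂ else ret false

/-- The tester. -/
noncomputable def tester (n R : ℕ) (H : Set (BoolFn (2 ^ R))) (s m t T M₁ M₂ : ℕ) : Proc n Bool :=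
  (unif (Fin n → Fin (2 ^ R))).andThen fun π => testColored π H s m t T M₁ M₂

/-! ### Query complexity -/

variable {π st} {f : BoolFn n} {D : PMF (Fin n → Bool)}

lemma cost_probe_le : (probe π st).cost f ≤ 3 :=
  cost_andThen_le (a := 1) (b := 2) cost_ex fun _ => le_rfl

lemma cost_search_le (m N : ℕ) (st : Found n R) :
    (search π m N st).cost f ≤ N * (3 * m + R) := by
  induction N generalizing st with
  | zero => simp [search, cost]
  | succ N ih =>
    have h : (search π m (N + 1) st).cost f ≤ m * 3 + (R + N * (3 * m + R)) := by
      refine cost_andThen_le (cost_repl cost_probe_le m) fun l => ?_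
      split
      · exact Nat.zero_le _
      · refine cost_andThen_le (cost_bisect_le _ _ _ _) fun a => ?_
        split_ifs
        · exact ih _
        · exact Nat.zero_le _
    refine h.trans (le_of_eq ?_)
    ring

lemma cost_classTest_le (t : ℕ) (c : Fin (2 ^ R)) : (classTest π st t c).cost f ≤ t * 12 :=
  cost_andThen_le (b := 0) (cost_repl (cost_literalTest _) t) fun _ => le_rfl

lemma cost_extract_le (x : Fin n → Bool) : (extract π st x).cost f ≤ st.colors.card * 2 := by
  refine (cost_andThen_le (a := 0) (b := st.colors.card * 2) cost_unif.le fun w => ?_).trans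
    (by simp)
  simpa using cost_collect_le (f := f) (k := 2) (a := fun c =>
    diffQuery (splice π c (st.witness c)) w x) (fun c => le_rfl) st.colors.toList

lemma cost_sample_le (T : ℕ) :
    (sample π st T).cost f ≤ 3 + (T + 1) * (st.colors.card * 2) := by
  refine (cost_andThen_le (a := 1) (b := 2 + (T + 1) * (st.colors.card * 2)) cost_ex fun x =>
    (cost_andThen_le (a := 1) (b := 1 + (T + 1) * (st.colors.card * 2)) le_rfl fun a =>
    (cost_andThen_le (a := (T + 1) * (st.colors.card * 2)) (b := 1)
      (cost_repl (cost_extract_le x) _) fun l => le_rfl).trans ?_).trans ?_).trans ?_ <;> omega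

lemma cost_cubeSample_le : (cubeSample π st).cost f ≤ 1 :=
  cost_andThen_le (a := 0) (b := 1) cost_unif.le fun _ => le_rfl

lemma cost_verify_le (H : Set (BoolFn (2 ^ R))) (t T M₁ M₂ : ℕ) {s : ℕ}
    (hs : st.colors.card ≤ s) :
    (verify π st H t T M₁ M₂).cost f ≤ s * (t * 12) + M₁ * (3 + (T + 1) * (s * 2)) + M₂ := by
  have h1 : (allOf (classTest π st t) st.colors.toList).cost f ≤ s * (t * 12) := by
    refine (cost_allOf_le (cost_classTest_le t) _).trans ?_
    rw [Finset.length_toList]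
    gcongr
  have h2 : (sample π st T).cost f ≤ 3 + (T + 1) * (s * 2) :=
    (cost_sample_le T).trans (by gcongr)
  refine (cost_andThen_le h1 fun b => cost_andThen_le (cost_repl h2 M₁) fun l₁ =>
    cost_andThen_le (b := 0) (cost_repl cost_cubeSample_le M₂) fun l₂ => le_rfl).trans ?_
  omega

lemma cost_tester_le (H : Set (BoolFn (2 ^ R))) (s m t T M₁ M₂ : ℕ) :
    (tester n R H s m t T M₁ M₂).cost f ≤
      (s + 1) * (3 * m + R) + (s * (t * 12) + M₁ * (3 + (T + 1) * (s * 2)) + M₂) := by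
  refine (cost_andThen_le (a := 0) cost_unif.le fun π =>
    cost_andThen_le (cost_search_le m (s + 1) _) fun o => ?_).trans (by rw [zero_add])
  split
  · exact Nat.zero_le _
  · split_ifs with h
    · exact cost_verify_le H t T M₁ M₂ h
    · exact Nat.zero_le _

/-! ### Completeness -/

/-- The value of `f` depends only on the variables in `S`. -/
def DependsOnly (f : BoolFn n) (S : Finset (Fin n)) : Prop :=
  ∀ x y, (∀ i ∈ S, x i = y i) → f x = f y

/-- Every found class makes `f` a literal in a relevant variable of the class. -/
def Found.Good (f : BoolFn n) (S : Finset (Fin n)) (π : Fin n → Fin (2 ^ R)) (st : Found n R) :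
    Prop :=
  ∀ c, (st c).isSome → ∃ i ∈ S, π i = c ∧ ∃ b, ∀ x, f (splice π c (st.witness c) x) = (x i ^^ b)

lemma hybrid_zero (x : Fin n → Bool) : hybrid π st x 0 = restrictTo π st x := by
  ext i; simp [hybrid, restrictTo]

lemma hybrid_top (x : Fin n → Bool) : hybrid π st x (2 ^ R) = x := by
  ext i; simp [hybrid]

lemma Found.mem_colors {c : Fin (2 ^ R)} : c ∈ st.colors ↔ (st c).isSome := by
  simp [Found.colors]

lemma Found.Good.card_le {S : Finset (Fin n)} (h : st.Good f S π) : st.colors.card ≤ S.card := by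
  classical
  refine (Finset.card_le_card (t := S.image π) fun c hc => ?_).trans Finset.card_image_le
  obtain ⟨i, hi, hc, _⟩ := h c (Found.mem_colors.1 hc)
  exact Finset.mem_image.2 ⟨i, hi, hc⟩

/-- Consecutive hybrids differ only on the class of colour `a`, and not at all if that class was
already found. By injectivity the class contains a single relevant variable `i`, which passes from 0
to 1 between the hybrids; hence `f` spliced into the class depends on `x i` alone and takes both
values. -/
lemma Found.Good.update {S : Finset (Fin n)} (hS : DependsOnly f S) (hπ : Set.InjOn π S)
    (h : st.Good f S π) {u : Fin n → Bool} {a : ℕ} (ha : a < 2 ^ R)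
    (hf : f (hybrid π st u a) ≠ f (hybrid π st u (a + 1))) :
    Found.Good f S π (Function.update st ⟨a, ha⟩ (some (hybrid π st u (a + 1)))) ∧
      st ⟨a, ha⟩ = none := by
  obtain ⟨i, hi, hne⟩ : ∃ i ∈ S, hybrid π st u a i ≠ hybrid π st u (a + 1) i := by
    by_contra! hc
    exact hf (hS _ _ hc)
  have hcol : (π i : ℕ) = a := by
    by_contra hc
    have : (π i : ℕ) < a + 1 ↔ (π i : ℕ) < a := by omega
    exact hne (by simp [hybrid, this])
  have hcol' : π i = ⟨a, ha⟩ := Fin.ext hcol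
  have hnone : st ⟨a, ha⟩ = none := by
    by_contra hc
    rw [← ne_eq, Option.ne_none_iff_isSome] at hc
    exact hne (by simp [hybrid, hcol', hc])
  refine ⟨fun c hc => ?_, hnone⟩
  by_cases hca : c = ⟨a, ha⟩
  · subst hca
    -- The new hybrid has value 1 at `i`, so the literal must give its `f`-value there; this fixes
    -- the sign.
    refine ⟨i, hi, hcol', !f (hybrid π st u (a + 1)), fun x => ?_⟩
    have hw : Found.witness (Function.update st ⟨a, ha⟩ (some (hybrid π st u (a + 1)))) ⟨a, ha⟩ =
        hybrid π st u (a + 1) := by simp [Found.witness]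
    rw [hw]
    have h0 : hybrid π st u a i = false := by simp [hybrid, hcol', hnone]
    have h1 : hybrid π st u (a + 1) i = true := by
      rw [h0] at hne
      simpa using Ne.symm hne
    cases hx : x i
    · have : f (splice π ⟨a, ha⟩ (hybrid π st u (a + 1)) x) = f (hybrid π st u a) := by
        refine hS _ _ fun j hj => ?_
        by_cases hjc : π j = ⟨a, ha⟩
        · obtain rfl : j = i := hπ hj hi (hjc.trans hcol'.symm)
          simp [splice, hjc, hx, h0]
        · have hne' : (π j : ℕ) ≠ a := fun h' => hjc (Fin.ext h')
          have : (π j : ℕ) < a + 1 ↔ (π j : ℕ) < a := by omega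
          simp [splice, hjc, hybrid, this]
      rw [this]
      revert hf
      cases f (hybrid π st u a) <;> cases f (hybrid π st u (a + 1)) <;> simp
    · have : f (splice π ⟨a, ha⟩ (hybrid π st u (a + 1)) x) = f (hybrid π st u (a + 1)) := by
        refine hS _ _ fun j hj => ?_
        by_cases hjc : π j = ⟨a, ha⟩
        · obtain rfl : j = i := hπ hj hi (hjc.trans hcol'.symm)
          simp [splice, hjc, hx, h1]
        · simp [splice, hjc]
      rw [this]
      simp
  · have h2 : Function.update st ⟨a, ha⟩ (some (hybrid π st u (a + 1))) c = st c :=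
      Function.update_of_ne hca _ _
    rw [h2] at hc
    have h3 : Found.witness (Function.update st ⟨a, ha⟩ (some (hybrid π st u (a + 1)))) c =
        st.witness c := by rw [Found.witness, h2]; rfl
    rw [h3]
    exact h c hc

lemma card_colors_update {c : Fin (2 ^ R)} (hc : st c = none) (v : Fin n → Bool) :
    (Found.colors (Function.update st c (some v))).card = st.colors.card + 1 := by
  have : Found.colors (Function.update st c (some v)) = insert c st.colors := by
    ext d
    rw [Finset.mem_insert, Found.mem_colors, Found.mem_colors]
    by_cases hd : d = c
    · subst hd; simp
    · simp [hd]
  rw [this, Finset.card_insert_of_notMem (by simp [Found.mem_colors, hc])]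

lemma sure_probe (st : Found n R) :
    (probe π st).Sure f fun t => t.2.1 = f (restrictTo π st t.1) ∧ t.2.2 = f t.1 :=
  fun _ => ⟨rfl, rfl⟩

/-- Every round that continues adds a colour, and a good state has at most `S.card` colours, so the
fuel `N` cannot run out. -/
lemma sure_search {S : Finset (Fin n)} (hS : DependsOnly f S) (hπ : Set.InjOn π S) (m N : ℕ)
    (st : Found n R) (h : st.Good f S π) (hN : S.card < st.colors.card + N) :
    (search π m N st).Sure f fun o => ∃ st', o = some st' ∧ st'.Good f S π := by
  induction N generalizing st with
  | zero => exact absurd h.card_le (by omega)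
  | succ N ih =>
    refine sure_andThen (sure_repl (sure_probe st) m) fun l hl => ?_
    split
    · exact ⟨st, rfl, h⟩
    · rename_i t ht
      obtain ⟨h1, h2⟩ := hl.2 t (List.mem_of_find?_eq_some ht)
      have h3 := List.find?_some ht
      simp only [bne_iff_ne, ne_eq, h1, h2, ← hybrid_zero] at h3
      rw [h1, ← hybrid_zero]
      refine sure_andThen (sure_bisect (hybrid π st t.1) R 0 ?_) fun a ha => ?_
      · rwa [zero_add, hybrid_top]
      · rw [zero_add] at ha
        rw [dif_pos ha.1]
        obtain ⟨h4, h5⟩ := h.update hS hπ ha.1 ha.2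
        exact ih _ h4 (by rw [card_colors_update h5]; omega)

lemma sure_classTest {S : Finset (Fin n)} (h : st.Good f S π) (t : ℕ) {c : Fin (2 ^ R)}
    (hc : c ∈ st.colors) : (classTest π st t c).Sure f (· = true) := by
  obtain ⟨i, _, _, b, hb⟩ := h c (Found.mem_colors.1 hc)
  refine sure_andThen (sure_repl (sure_literalTest hb) t) fun l hl => ?_
  change l.all id = true
  rw [List.all_eq_true]
  exact hl.2

lemma sure_extract (w x : Fin n → Bool) :
    (collect (fun c => diffQuery (splice π c (st.witness c)) w x) st.colors.toList).Sure f
      (· = fun c => (st c).isSome && (f (splice π c (st.witness c) (vxor w x)) ^^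
        f (splice π c (st.witness c) w))) := by
  refine (sure_collect (a := fun c => diffQuery (splice π c (st.witness c)) w x) (v := fun c => (f (splice π c (st.witness c) (vxor w x)) ^^
        f (splice π c (st.witness c) w))) (fun c => rfl) _).mono fun y hy => ?_
  rw [hy]
  ext c
  simp [Found.mem_colors]

lemma blowUp_mask (y : Fin (2 ^ R) → Bool) : blowUp π st (st.mask y) = blowUp π st y := by
  ext i
  simp only [blowUp, Found.mask]
  cases (st (π i)).isSome <;> simp

lemma sure_sample {S : Finset (Fin n)} (hS : DependsOnly f S) (hπ : Set.InjOn π S)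
    (h : st.Good f S π) (T : ℕ) :
    (sample π st T).Sure f fun e => e.1 = true ∧ f (blowUp π st e.2.1) = e.2.2 := by
  intro x
  -- For a literal the base point cancels in the difference, so the arbitrary base point `x` may be
  -- used to name the extracted value.
  let z : Fin (2 ^ R) → Bool := fun c => (st c).isSome &&
    (f (splice π c (st.witness c) (vxor x x)) ^^ f (splice π c (st.witness c) x))
  have hz : ∀ c w, ((st c).isSome && (f (splice π c (st.witness c) (vxor w x)) ^^
      f (splice π c (st.witness c) w))) = true ↔ ∃ i ∈ S, π i = c ∧ (st c).isSome ∧ x i = true := by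
    intro c w
    by_cases hc : (st c).isSome
    · obtain ⟨i, hi, hic, b, hb⟩ := h c hc
      rw [hb, hb, hc, Bool.true_and]
      have : ((vxor w x i ^^ b) ^^ (w i ^^ b)) = x i := by
        simp only [vxor]
        cases w i <;> cases x i <;> cases b <;> rfl
      rw [this]
      constructor
      · exact fun hx => ⟨i, hi, hic, rfl, hx⟩
      · rintro ⟨j, hj, hjc, -, hx⟩
        rwa [hπ hj hi (hjc.trans hic.symm)] at hx
    · simp [hc]
  have hex : (extract π st x).Sure f (· = z) := by
    refine sure_andThen (sure_true _) fun w _ => (sure_extract w x).mono fun y hy => ?_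
    rw [hy]
    ext c
    exact Bool.eq_iff_iff.2 ((hz c w).trans (hz c x).symm)
  change ((repl (extract π st x) (T + 1)).andThen _).Sure f _
  refine sure_andThen (sure_repl hex (T + 1)) fun l hl => ?_
  -- There are `T + 1` attempts, so the list is nonempty and the default is never used.
  have hhead : l.headD (fun _ => false) = z := by
    cases l with
    | nil => simp at hl
    | cons a l => exact hl.2 a (by simp)
  have hval : f (blowUp π st z) = f (restrictTo π st x) := by
    refine hS _ _ fun i hi => Bool.eq_iff_iff.2 ?_
    have := hz (π i) x
    simp only [blowUp, restrictTo, Bool.and_eq_true]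
    constructor
    · rintro ⟨h1, h2⟩
      obtain ⟨j, hj, hjc, -, hx⟩ := this.1 h2
      rw [hπ hj hi hjc] at hx
      exact ⟨h1, hx⟩
    · rintro ⟨h1, h2⟩
      exact ⟨h1, this.2 ⟨i, hi, rfl, h1, h2⟩⟩
  change (decide _ && (_ == _)) = true ∧ _ = _
  rw [hhead, blowUp_mask, hval]
  simp only [beq_self_eq_true, Bool.and_true, decide_eq_true_eq, and_true]
  exact hl.2

lemma sure_verify {S : Finset (Fin n)} (hS : DependsOnly f S) (hπ : Set.InjOn π S)
    (h : st.Good f S π) {H : Set (BoolFn (2 ^ R))} (hH : (fun y => f (blowUp π st y)) ∈ H)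
    (t T M₁ M₂ : ℕ) : (verify π st H t T M₁ M₂).Sure f (· = true) := by
  classical
  refine sure_andThen (sure_allOf fun c hc => sure_classTest h t (Finset.mem_toList.1 hc))
    fun b hb => sure_andThen (sure_repl (sure_sample hS hπ h T) M₁) fun l₁ h₁ =>
      sure_andThen (P := fun l => l.length = M₂ ∧ ∀ e ∈ l, f (blowUp π st e.1) = e.2)
        (sure_repl ?_ M₂) fun l₂ h₂ => ?_
  · refine sure_andThen (sure_true _) fun y _ => ?_
    change f (blowUp π st (st.mask y)) = f (blowUp π st y)
    rw [blowUp_mask]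
  · refine Bool.and_eq_true_iff.2 ⟨hb, decide_eq_true ?_⟩
    exact ⟨_, hH, h₁.2, h₂.2⟩

lemma sure_testColored {S : Finset (Fin n)} (hS : DependsOnly f S) (hπ : Set.InjOn π S)
    {H : Set (BoolFn (2 ^ R))} (hH : ∀ st, (fun y => f (blowUp π st y)) ∈ H) {s : ℕ}
    (hs : S.card ≤ s) (m t T M₁ M₂ : ℕ) :
    (testColored π H s m t T M₁ M₂).Sure f (· = true) := by
  refine sure_andThen (sure_search hS hπ m (s + 1) _ ?_ (by omega)) ?_
  · intro c hc
    simp at hc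
  · rintro _ ⟨st, rfl, h⟩
    change (if st.colors.card ≤ s then _ else _ : Proc n Bool).Sure f _
    rw [if_pos (h.card_le.trans hs)]
    exact sure_verify hS hπ h (hH st) t T M₁ M₂

/-- Recolouring `i` arbitrarily in a colouring with `π i = π j` loses nothing: the old colour of `i`
can still be read off at `j`. -/
lemma card_collision {i j : Fin n} (hij : i ≠ j) :
    (Finset.univ.filter fun π : Fin n → Fin (2 ^ R) => π i = π j).card * 2 ^ R ≤
      Fintype.card (Fin n → Fin (2 ^ R)) := by
  have : ((Finset.univ.filter fun π : Fin n → Fin (2 ^ R) => π i = π j) ×ˢ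
      (Finset.univ : Finset (Fin (2 ^ R)))).card ≤
      (Finset.univ : Finset (Fin n → Fin (2 ^ R))).card := by
    refine Finset.card_le_card_of_injOn (fun p => Function.update p.1 i p.2)
      (fun _ _ => Finset.mem_coe.2 (Finset.mem_univ _)) ?_
    rintro ⟨p, c⟩ hp ⟨p', c'⟩ hp' h
    simp only [Finset.coe_product, Finset.coe_filter, Finset.mem_univ, true_and,
      Finset.coe_univ, Set.mem_prod, Set.mem_ofPred_eq, Set.mem_univ, and_true] at hp hp'
    dsimp only at h
    have h1 : c = c' := by simpa using congrFun h i
    have h2 : ∀ k, k ≠ i → p k = p' k := fun k hk => by simpa [hk] using congrFun h k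
    refine Prod.ext (funext fun k => ?_) h1
    by_cases hk : k = i
    · subst hk
      exact (hp.trans (h2 j (Ne.symm hij))).trans hp'.symm
    · exact h2 k hk
  simpa [Finset.card_product] using this

lemma prob_not_injOn_le (S : Finset (Fin n)) :
    (unif (Fin n → Fin (2 ^ R))).prob f D (fun π => ¬ Set.InjOn π S) ≤
      (S.card : ℝ) ^ 2 / 2 ^ R := by
  classical
  have h1 := prob_exists_le (f := f) (D := D) (unif (Fin n → Fin (2 ^ R))) S.offDiag
    (fun p π => π p.1 = π p.2) (c := 1 / 2 ^ R) ?_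
  · refine (prob_mono _ (Q := fun π => ∃ p ∈ S.offDiag, π p.1 = π p.2) fun π hπ => ?_).trans
      (h1.trans ?_)
    · simp only [Set.InjOn] at hπ
      push Not at hπ
      obtain ⟨i, hi, j, hj, h2, h3⟩ := hπ
      exact ⟨(i, j), Finset.mem_offDiag.2 ⟨hi, hj, h3⟩, h2⟩
    · rw [mul_one_div]
      gcongr
      have : S.offDiag.card ≤ S.card ^ 2 := by rw [Finset.offDiag_card, sq]; omega
      exact_mod_cast this
  · intro p hp
    rw [prob_unif, div_le_div_iff₀ (by exact_mod_cast Fintype.card_pos) (by positivity), one_mul]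
    exact_mod_cast card_collision (R := R) (Finset.mem_offDiag.1 hp).2.2

/-- A member can be rejected only when two relevant variables collide, which has probability at most
1/4. -/
theorem prob_tester_ge {S : Finset (Fin n)} (hS : DependsOnly f S) {s : ℕ} (hs : S.card ≤ s)
    (hR : 4 * s ^ 2 ≤ 2 ^ R) {H : Set (BoolFn (2 ^ R))}
    (hH : ∀ π st, (fun y => f (blowUp π st y)) ∈ H) (m t T M₁ M₂ : ℕ) :
    2 / 3 ≤ (tester n R H s m t T M₁ M₂).prob f D (· = true) := by
  have h1 := prob_andThen_le (f := f) (D := D) (p := unif (Fin n → Fin (2 ^ R)))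
    (q := fun π => testColored π H s m t T M₁ M₂) (Q := fun b => ¬ b = true)
    (fun π => ¬ Set.InjOn π S) le_rfl fun π hπ => by
      rw [prob_not, prob_eq_one_of_sure (sure_testColored hS (not_not.1 hπ) (hH π) hs m t T M₁ M₂),
        sub_self]
  have h2 := prob_not_injOn_le (R := R) (f := f) (D := D) S
  rw [prob_not] at h1
  have h3 : (S.card : ℝ) ^ 2 / 2 ^ R ≤ 1 / 4 := by
    rw [div_le_div_iff₀ (by positivity) (by norm_num)]
    have h4 : 4 * S.card ^ 2 ≤ 2 ^ R := le_trans (by gcongr) hR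
    have : (4 : ℝ) * S.card ^ 2 ≤ 2 ^ R := by exact_mod_cast h4
    linarith
  rw [tester]
  linarith

end Tester

/-! ### Soundness -/

section Soundness

open Proc

variable {n R : ℕ} {π : Fin n → Fin (2 ^ R)} {st : Found n R} {f : BoolFn n}
  {D : PMF (Fin n → Bool)}

lemma disagreement_eq_prob (f : BoolFn n) (D : PMF (Fin n → Bool)) (g h : BoolFn n) :
    disagreement D g h = ex.prob f D fun x => g x ≠ h x := by
  rw [prob_ex]
  rfl

lemma prob_ex_eq (f : BoolFn n) (D : PMF (Fin n → Bool)) (g h : BoolFn n) :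
    (ex.prob f D fun x => g x = h x) = 1 - disagreement D g h := by
  rw [disagreement_eq_prob f, ← prob_not]
  simp only [not_not]

lemma disagreement_triangle (D : PMF (Fin n → Bool)) (g h k : BoolFn n) :
    disagreement D g k ≤ disagreement D g h + disagreement D h k := by
  simp only [disagreement_eq_prob (fun _ => false)]
  refine (prob_mono _ fun x hx => ?_).trans (prob_or_le _ _ _)
  by_contra! hc
  exact hx (hc.1.trans hc.2)

lemma disagreement_comm (D : PMF (Fin n → Bool)) (g h : BoolFn n) :
    disagreement D g h = disagreement D h g := by
  simp only [disagreement, ne_comm]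

lemma disagreement_le_one (D : PMF (Fin n → Bool)) (g h : BoolFn n) :
    disagreement D g h ≤ 1 := by
  rw [disagreement_eq_prob (fun _ => false)]
  exact prob_le_one _ _

/-- At the start of a round the state is fixed. If its restriction is more than `α` away from `f`,
all `m` fresh probes agree with probability at most `(1 - α) ^ m`; sum over the rounds. -/
lemma prob_search_le {α : ℝ} (hα1 : α ≤ 1) (m N : ℕ) (st : Found n R) :
    (search π m N st).prob f D (fun o => ∃ st', o = some st' ∧
      α < disagreement D f fun x => f (restrictTo π st' x)) ≤ N * (1 - α) ^ m := by
  have hp : 0 ≤ (1 - α) ^ m := pow_nonneg (by linarith) m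
  induction N generalizing st with
  | zero =>
    rw [search, prob_ret]
    simp
  | succ N ih =>
    have hN : (0 : ℝ) ≤ N * (1 - α) ^ m := by positivity
    rw [search]
    have hrec : ∀ (t : (Fin n → Bool) × Bool × Bool),
        ((bisect (hybrid π st t.1) R 0 t.2.1).andThen fun a =>
          if h : a < 2 ^ R then
            search π m N (Function.update st ⟨a, h⟩ (some (hybrid π st t.1 (a + 1))))
          else ret none).prob f D (fun o => ∃ st', o = some st' ∧
            α < disagreement D f fun x => f (restrictTo π st' x)) ≤ N * (1 - α) ^ m := by
      intro t
      refine prob_andThen_le_of_forall fun a => ?_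
      split_ifs
      · exact ih _
      · rw [prob_ret]
        simpa using hN
    by_cases hst : α < disagreement D f fun x => f (restrictTo π st x)
    · have h1 : (repl (probe π st) m).prob f D (fun l => ∀ t ∈ l, t.2.1 = t.2.2) ≤
          (1 - α) ^ m := by
        rw [prob_repl]
        have h2 : (probe π st).prob f D (fun t => t.2.1 = t.2.2) =
            1 - disagreement D f fun x => f (restrictTo π st x) := by
          rw [disagreement_comm, ← prob_ex_eq f, probe, prob_andThen]
          simp only [prob_mem_andThen, prob_ret]
          rw [prob]
          congr 1
          ext x
          congr
        rw [h2]
        have := disagreement_le_one D f fun x => f (restrictTo π st x)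
        exact pow_le_pow_left₀ (by linarith) (by linarith) m
      refine (prob_andThen_le _ hN fun l hl => ?_).trans ((add_le_add_left h1 _).trans ?_)
      · split
        · rename_i h
          refine absurd (fun t ht => ?_) hl
          have := List.find?_eq_none.1 h t ht
          simpa using this
        · exact hrec _
      · push_cast
        linarith
    · refine (prob_andThen_le_of_forall (b := N * (1 - α) ^ m) fun l => ?_).trans ?_
      · split
        · rw [prob_ret, if_neg]
          · exact hN
          · rintro ⟨st', h1, h2⟩
            rw [← Option.some_injective _ h1] at h2
            exact hst h2
        · exact hrec _
      · push_cast
        linarith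

lemma prob_classTest_le {c : Fin (2 ^ R)}
    (h : (literalTest (splice π c (st.witness c))).prob f D (· = true) ≤ 31 / 32) (t : ℕ) :
    (classTest π st t c).prob f D (· = true) ≤ (31 / 32) ^ t := by
  rw [← add_zero ((31 / 32 : ℝ) ^ t)]
  refine (prob_andThen_le (fun l => ∀ a ∈ l, a = true) le_rfl fun l hl => ?_).trans ?_
  · rw [prob_ret, if_neg]
    simpa [List.all_eq_true] using hl
  · rw [prob_repl, add_zero, add_zero]
    exact pow_le_pow_left₀ (prob_nonneg _ _) h t

/-- The assignment to the colours given by the chosen variables. -/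
def readOff (st : Found n R) (τ : Fin (2 ^ R) → Fin n) (x : Fin n → Bool) : Fin (2 ^ R) → Bool :=
  fun c => (st c).isSome && x (τ c)

/-- For every found colour, the self-corrector computes the variable chosen for it. -/
def Reads (f : BoolFn n) (D : PMF (Fin n → Bool)) (π : Fin n → Fin (2 ^ R)) (st : Found n R)
    (τ : Fin (2 ^ R) → Fin n) : Prop :=
  ∀ c ∈ st.colors, ∀ x, (unif (Fin n → Bool)).prob f D (fun w =>
    (f (splice π c (st.witness c) (vxor w x)) ^^ f (splice π c (st.witness c) w)) ≠ x (τ c)) ≤ 1 / 16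

/-- If `τ c` lay outside the class, flipping it would not change the spliced string, so the
difference in that direction would always be 0 instead of 1. -/
lemma Reads.color_eq {τ : Fin (2 ^ R) → Fin n} (h : Reads f D π st τ) {c : Fin (2 ^ R)}
    (hc : c ∈ st.colors) : π (τ c) = c := by
  by_contra hne
  have h1 := h c hc fun i => decide (i = τ c)
  have h2 : ∀ w, splice π c (st.witness c) (vxor w fun i => decide (i = τ c)) =
      splice π c (st.witness c) w := fun w => by
    ext i
    by_cases hi : i = τ c
    · subst hi; simp [splice, hne]
    · simp [splice, vxor, hi]
  have h3 : (unif (Fin n → Bool)).prob f D (fun w =>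
    (f (splice π c (st.witness c) (vxor w fun i => decide (i = τ c))) ^^
      f (splice π c (st.witness c) w)) ≠ decide (τ c = τ c)) = 1 := by
    refine prob_eq_one_of_sure (sure_unif fun w => ?_)
    rw [h2]
    simp
  rw [h3] at h1
  norm_num at h1

lemma prob_extract_le {τ : Fin (2 ^ R) → Fin n} (h : Reads f D π st τ) {c : Fin (2 ^ R)}
    (hc : c ∈ st.colors) (x : Fin n → Bool) :
    (extract π st x).prob f D (fun y => y c ≠ x (τ c)) ≤ 1 / 16 := by
  rw [← add_zero (1 / 16 : ℝ)]
  refine (prob_andThen_le _ le_rfl fun w hw => ?_).trans (add_le_add_left (h c hc x) 0)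
  rw [not_not] at hw
  -- The trivial continuation `ret` brings the statement into the form of a composition; `h2`
  -- removes it.
  have h1 := prob_andThen_of_sure_eq (D := D) (sure_extract (f := f) (π := π) (st := st) w x)
    (fun y => ret y) (fun y => y c ≠ x (τ c))
  have h2 : ∀ p : Proc n (Fin (2 ^ R) → Bool), (p.andThen fun y => ret y).prob f D
      (fun y => y c ≠ x (τ c)) = p.prob f D (fun y => y c ≠ x (τ c)) := fun p =>
    prob_andThen _ _ _
  rw [h2, prob_ret, if_neg] at h1
  · rw [h1]
  · dsimp only
    rw [not_not, ← hw, (Found.mem_colors.1 hc), Bool.true_and]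

/-- All attempts must agree, so a wrong common value at `c` needs all `T + 1` attempts to be wrong
at `c`. A union bound over the colours costs only `(1 / 16) ^ (T + 1)` each, although a single
attempt may well err somewhere. Outside this event the sample is the true `readOff`. -/
lemma prob_sample_le {τ : Fin (2 ^ R) → Fin n} (h : Reads f D π st τ)
    (Q : (Fin (2 ^ R) → Bool) → Bool → Prop) (T : ℕ) :
    (sample π st T).prob f D (fun e => e.1 = true ∧ Q e.2.1 e.2.2) ≤
      ex.prob f D (fun x => Q (readOff st τ x) (f (restrictTo π st x)) ∧
        f (blowUp π st (readOff st τ x)) = f (restrictTo π st x)) +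
      st.colors.card * (1 / 16) ^ (T + 1) := by
  refine prob_andThen_le _ (by positivity) fun x hx => ?_
  rw [prob_mem_andThen, ← add_zero ((st.colors.card : ℝ) * _)]
  have h1 := prob_exists_le (f := f) (D := D) (repl (extract π st x) (T + 1)) st.colors
    (fun c l => ∀ y ∈ l, y c ≠ x (τ c)) (c := (1 / 16) ^ (T + 1)) fun c hc => by
      rw [prob_repl]
      exact pow_le_pow_left₀ (prob_nonneg _ _) (prob_extract_le h hc x) _
  refine (prob_andThen_le _ le_rfl fun l hl => ?_).trans (add_le_add_left h1 0)
  classical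
  rw [prob_mem_andThen, prob_ret, if_neg]
  push Not at hl
  rintro ⟨h2, h3⟩
  simp only [Bool.and_eq_true, decide_eq_true_eq, beq_iff_eq] at h2 h3
  have h4 : st.mask (l.headD fun _ => false) = readOff st τ x := by
    ext c
    simp only [Found.mask, readOff]
    by_cases hc : c ∈ st.colors
    · obtain ⟨y, hy, hyc⟩ := hl c hc
      rw [← h2.1 y hy, hyc]
    · rw [Found.mem_colors] at hc
      simp [hc]
  rw [h4] at h3
  refine hx ⟨h3, ?_⟩
  rw [← h4, blowUp_mask]
  exact h2.2.symm

/-- Restricting uniform bits to a subset of the positions gives uniform bits. -/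
lemma sum_comp_injective {κ ι : Type*} [Fintype κ] [Fintype ι] [DecidableEq κ] [DecidableEq ι]
    {τ : κ → ι} (hτ : Function.Injective τ) (Ψ : (κ → Bool) → ℝ) :
    (∑ x : ι → Bool, Ψ (x ∘ τ)) / Fintype.card (ι → Bool) =
      (∑ u, Ψ u) / Fintype.card (κ → Bool) := by
  classical
  -- Split off the bits in the range of `τ`; the other bits contribute the same factor to numerator
  -- and denominator.
  let e := Equiv.piEquivPiSubtypeProd (· ∈ Set.range τ) fun _ : ι => Bool
  let e' : ({i // i ∈ Set.range τ} → Bool) ≃ (κ → Bool) :=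
    (Equiv.ofInjective τ hτ).symm.arrowCongr (Equiv.refl Bool)
  let E := e.trans (e'.prodCongr (Equiv.refl _))
  have h1 : ∀ x, (E x).1 = x ∘ τ := fun x => by
    ext k
    simp [E, e, e', Equiv.arrowCongr, Equiv.piEquivPiSubtypeProd]
  have h2 := Equiv.sum_comp E fun p => Ψ p.1
  simp only [h1] at h2
  rw [h2, Fintype.card_congr E, Fintype.card_prod, Fintype.sum_prod_type]
  simp only [Finset.sum_const, Finset.card_univ, nsmul_eq_mul, ← Finset.mul_sum]
  push_cast
  rw [mul_comm (Fintype.card (κ → Bool) : ℝ)]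
  refine mul_div_mul_left _ _ ?_
  exact_mod_cast Fintype.card_ne_zero

/-- The colour hypothesis makes `τ` injective on the found colours. So a uniform colour assignment
and `readOff` of a uniform input have the same law there, and both sides are the same average over
uniform bits indexed by the found colours. -/
lemma prob_cubeSample_eq {τ : Fin (2 ^ R) → Fin n}
    (h : ∀ c ∈ st.colors, π (τ c) = c) (G : BoolFn (2 ^ R)) :
    (cubeSample π st).prob f D (fun e => G e.1 = e.2) =
      1 - disagreement (PMF.uniformOfFintype (Fin n → Bool))
        (fun x => f (blowUp π st (readOff st τ x))) fun x => G (readOff st τ x) := by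
  classical
  rw [disagreement_comm, ← prob_ex_eq f, cubeSample, prob_andThen, expect_unif]
  simp only [prob_mem_andThen, prob_ret]
  rw [prob_ex]
  simp only [PMF.uniformOfFintype_apply, ENNReal.toReal_inv, ENNReal.toReal_natCast]
  rw [Finset.sum_filter]
  let ext (u : {c // c ∈ st.colors} → Bool) : Fin (2 ^ R) → Bool :=
    fun c => if hc : c ∈ st.colors then u ⟨c, hc⟩ else false
  let Ψ (u : {c // c ∈ st.colors} → Bool) : ℝ := if G (ext u) = f (blowUp π st (ext u)) then 1 else 0
  have h1 := sum_comp_injective (τ := fun c : {c // c ∈ st.colors} => c.1)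
    Subtype.val_injective Ψ
  have h2 := sum_comp_injective (τ := fun c : {c // c ∈ st.colors} => τ c.1)
    (fun c d hcd => Subtype.ext (by rw [← h c c.2, ← h d d.2]; exact congrArg π hcd)) Ψ
  have e1 : ∀ y : Fin (2 ^ R) → Bool,
      ext (y ∘ fun c : {c // c ∈ st.colors} => c.1) = st.mask y := fun y => by
    ext c
    by_cases hc : c ∈ st.colors
    · simp [ext, Found.mask, hc, Found.mem_colors.1 hc]
    · have := Found.mem_colors.not.1 hc
      simp only [ext, Found.mask, hc, dite_false, this, Bool.false_and]
  have e2 : ∀ x : Fin n → Bool,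
      ext (x ∘ fun c : {c // c ∈ st.colors} => τ c.1) = readOff st τ x := fun x => by
    ext c
    by_cases hc : c ∈ st.colors
    · simp [ext, readOff, hc, Found.mem_colors.1 hc]
    · have := Found.mem_colors.not.1 hc
      simp only [ext, readOff, hc, dite_false, this, Bool.false_and]
  simp only [Ψ, e1, blowUp_mask] at h1
  simp only [Ψ, e2] at h2
  rw [h1, ← h2, Finset.sum_div]
  exact Finset.sum_congr rfl fun x _ => by split_ifs <;> simp

lemma prob_verify_le_of_classTest {c : Fin (2 ^ R)} (hc : c ∈ st.colors)
    {H : Set (BoolFn (2 ^ R))} (t T M₁ M₂ : ℕ) :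
    (verify π st H t T M₁ M₂).prob f D (· = true) ≤ (classTest π st t c).prob f D (· = true) := by
  rw [← add_zero ((classTest π st t c).prob f D (· = true))]
  refine (prob_andThen_le _ le_rfl fun b hb => prob_andThen_le_of_forall fun l₁ =>
    prob_andThen_le_of_forall fun l₂ => ?_).trans (add_le_add_left (prob_allOf_le _
      (Finset.mem_toList.2 hc)) 0)
  rw [prob_ret, if_neg]
  exact fun h => hb (Bool.and_eq_true_iff.1 h).1

/-- Union bound over the candidates, each of which must survive all `M₁` samples. -/
lemma prob_verify_le_of_sample {H : Set (BoolFn (2 ^ R))} (t T M₁ M₂ : ℕ) {p : ℝ}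
    (h : ∀ G ∈ H, (sample π st T).prob f D (fun e => e.1 = true ∧ G e.2.1 = e.2.2) ≤ p) :
    (verify π st H t T M₁ M₂).prob f D (· = true) ≤ H.ncard * p ^ M₁ := by
  classical
  rw [Set.ncard_eq_toFinset_card H, ← add_zero ((H.toFinite.toFinset.card : ℝ) * _)]
  refine prob_andThen_le_of_forall fun b => (prob_andThen_le _ le_rfl fun l₁ hl =>
    prob_andThen_le_of_forall fun l₂ => ?_).trans (add_le_add_left (prob_exists_le _ _
      (fun G l => ∀ e ∈ l, e.1 = true ∧ G e.2.1 = e.2.2) fun G hG => ?_) 0)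
  · rw [prob_ret, if_neg]
    intro hc
    obtain ⟨G, hG, h1, -⟩ := of_decide_eq_true (Bool.and_eq_true_iff.1 hc).2
    exact hl ⟨G, H.toFinite.mem_toFinset.2 hG, h1⟩
  · rw [prob_repl]
    exact pow_le_pow_left₀ (prob_nonneg _ _) (h G (H.toFinite.mem_toFinset.1 hG)) _

/-- The flag does not involve the candidate, so no factor `H.ncard` appears; in the uniform model
this keeps the number of expensive samples independent of `s`. -/
lemma prob_verify_le_of_flag {H : Set (BoolFn (2 ^ R))} (t T M₁ M₂ : ℕ) {p : ℝ}
    (h : (sample π st T).prob f D (fun e => e.1 = true) ≤ p) :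
    (verify π st H t T M₁ M₂).prob f D (· = true) ≤ p ^ M₁ := by
  classical
  rw [← add_zero (p ^ M₁)]
  refine prob_andThen_le_of_forall fun b => (prob_andThen_le (fun l => ∀ e ∈ l, e.1 = true) le_rfl
    fun l₁ hl => prob_andThen_le_of_forall fun l₂ => ?_).trans (add_le_add_left ?_ 0)
  · rw [prob_ret, if_neg]
    intro hc
    obtain ⟨G, hG, h1, -⟩ := of_decide_eq_true (Bool.and_eq_true_iff.1 hc).2
    exact hl fun e he => (h1 e he).1
  · rw [prob_repl]
    exact pow_le_pow_left₀ (prob_nonneg _ _) h _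

lemma prob_verify_le_of_cubeSample {H : Set (BoolFn (2 ^ R))} (t T M₁ M₂ : ℕ) {p : ℝ}
    (h : ∀ G ∈ H, (cubeSample π st).prob f D (fun e => G e.1 = e.2) ≤ p) :
    (verify π st H t T M₁ M₂).prob f D (· = true) ≤ H.ncard * p ^ M₂ := by
  classical
  rw [Set.ncard_eq_toFinset_card H, ← add_zero ((H.toFinite.toFinset.card : ℝ) * _)]
  refine prob_andThen_le_of_forall fun b => prob_andThen_le_of_forall fun l₁ =>
    (prob_andThen_le _ le_rfl fun l₂ hl => ?_).trans (add_le_add_left (prob_exists_le _ _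
      (fun G l => ∀ e ∈ l, G e.1 = e.2) fun G hG => ?_) 0)
  · rw [prob_ret, if_neg]
    intro hc
    obtain ⟨G, hG, -, h1⟩ := of_decide_eq_true (Bool.and_eq_true_iff.1 hc).2
    exact hl ⟨G, H.toFinite.mem_toFinset.2 hG, h1⟩
  · rw [prob_repl]
    exact pow_le_pow_left₀ (prob_nonneg _ _) (h G (H.toFinite.mem_toFinset.1 hG)) _

lemma exists_reads [Nonempty (Fin n)] (f : BoolFn n) (D : PMF (Fin n → Bool))
    (π : Fin n → Fin (2 ^ R)) (st : Found n R) :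
    (∃ c ∈ st.colors, (literalTest (splice π c (st.witness c))).prob f D (· = true) ≤ 31 / 32) ∨
      ∃ τ, Reads f D π st τ := by
  by_cases h : ∃ c ∈ st.colors,
    (literalTest (splice π c (st.witness c))).prob f D (· = true) ≤ 31 / 32
  · exact Or.inl h
  · push Not at h
    right
    have h1 : ∀ c, ∃ i : Fin n, c ∈ st.colors → ∀ x, (unif (Fin n → Bool)).prob f D (fun w =>
        (f (splice π c (st.witness c) (vxor w x)) ^^ f (splice π c (st.witness c) w)) ≠ x i) ≤
          1 / 16 := by
      intro c
      by_cases hc : c ∈ st.colors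
      · obtain ⟨i, hi⟩ := (literalTest_or_selfCorrect (f := f) (D := D)
          (splice π c (st.witness c))).resolve_left (not_le.2 (h c hc))
        exact ⟨i, fun _ => hi⟩
      · exact ⟨Classical.arbitrary _, fun h' => absurd h' hc⟩
    choose τ hτ using h1
    exact ⟨τ, hτ⟩

/-- Of the distance `4 * α`, restriction loses `α` and misreading another `α`, so each candidate
fails a sample with probability at least `2 * α`. -/
lemma prob_verify_le [Nonempty (Fin n)] {H : Set (BoolFn (2 ^ R))} {t T M₁ : ℕ} (M₂ : ℕ)
    {α B : ℝ} (hT : st.colors.card * (1 / 16) ^ (T + 1) ≤ α)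
    (hst : disagreement D f (fun x => f (restrictTo π st x)) ≤ α)
    (hfar : ∀ G ∈ H, ∀ τ, 4 * α ≤ disagreement D f fun x => G (readOff st τ x))
    (ht : (31 / 32) ^ t ≤ B) (hM₁ : H.ncard * (1 - α) ^ M₁ ≤ B) :
    (verify π st H t T M₁ M₂).prob f D (· = true) ≤ B := by
  have hα : 0 ≤ α := le_trans (by positivity) hT
  rcases exists_reads f D π st with ⟨c, hc, h⟩ | ⟨τ, hτ⟩
  · exact (prob_verify_le_of_classTest hc t T M₁ M₂).trans ((prob_classTest_le h t).trans ht)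
  · refine (prob_verify_le_of_sample t T M₁ M₂ fun G hG => ?_).trans hM₁
    refine (prob_sample_le hτ (fun z b => G z = b) T).trans ?_
    have h1 : ex.prob f D (fun x => G (readOff st τ x) = f (restrictTo π st x) ∧
        f (blowUp π st (readOff st τ x)) = f (restrictTo π st x)) ≤
        1 - disagreement D (fun x => G (readOff st τ x)) fun x => f (restrictTo π st x) := by
      rw [← prob_ex_eq f]
      exact prob_mono _ fun x hx => hx.1
    have h2 := disagreement_triangle D f (fun x => f (restrictTo π st x))
      fun x => G (readOff st τ x)
    rw [disagreement_comm D (fun x => f (restrictTo π st x))] at h2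
    have h3 := hfar G hG τ
    linarith

/-- If the blown-up function is `2 * α` away from the restricted one, the flag fails with
probability at least `α` after the misreading loss. Otherwise the blown-up function is within `3 *
α` of `f`, so every candidate is still more than `α` away from it and is refuted by the cube
samples. -/
lemma prob_verify_le_uniform [Nonempty (Fin n)] {H : Set (BoolFn (2 ^ R))} {t T M₁ M₂ : ℕ}
    {α B : ℝ} (hT : st.colors.card * (1 / 16) ^ (T + 1) ≤ α)
    (hD : D = PMF.uniformOfFintype (Fin n → Bool))
    (hst : disagreement D f (fun x => f (restrictTo π st x)) ≤ α)
    (hfar : ∀ G ∈ H, ∀ τ, 4 * α ≤ disagreement D f fun x => G (readOff st τ x))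
    (ht : (31 / 32) ^ t ≤ B) (hM₁ : (1 - α) ^ M₁ ≤ B) (hM₂ : H.ncard * (1 - α) ^ M₂ ≤ B) :
    (verify π st H t T M₁ M₂).prob f D (· = true) ≤ B := by
  have hα : 0 ≤ α := le_trans (by positivity) hT
  rcases exists_reads f D π st with ⟨c, hc, h⟩ | ⟨τ, hτ⟩
  · exact (prob_verify_le_of_classTest hc t T M₁ M₂).trans ((prob_classTest_le h t).trans ht)
  by_cases hF : 2 * α ≤ disagreement D (fun x => f (blowUp π st (readOff st τ x)))
      fun x => f (restrictTo π st x)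
  · refine (prob_verify_le_of_flag t T M₁ M₂ ?_).trans hM₁
    have h0 := prob_sample_le hτ (fun _ _ => True) T
    simp only [and_true, true_and] at h0
    refine h0.trans ?_
    rw [prob_ex_eq]
    linarith
  · refine (prob_verify_le_of_cubeSample t T M₁ M₂ fun G hG => ?_).trans hM₂
    rw [prob_cubeSample_eq (fun c hc => hτ.color_eq hc), ← hD]
    have h1 := hfar G hG τ
    have h2 := disagreement_triangle D f (fun x => f (restrictTo π st x))
      fun x => G (readOff st τ x)
    have h3 := disagreement_triangle D (fun x => f (restrictTo π st x))
      (fun x => f (blowUp π st (readOff st τ x))) fun x => G (readOff st τ x)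
    rw [disagreement_comm D (fun x => f (restrictTo π st x))
      fun x => f (blowUp π st (readOff st τ x))] at h3
    linarith

lemma prob_tester_le {H : Set (BoolFn (2 ^ R))} {s m t T M₁ M₂ : ℕ} {α B : ℝ} (hα : α ≤ 1)
    (hB : 0 ≤ B)
    (h : ∀ (π : Fin n → Fin (2 ^ R)) (st : Found n R), st.colors.card ≤ s →
      disagreement D f (fun x => f (restrictTo π st x)) ≤ α →
      (verify π st H t T M₁ M₂).prob f D (· = true) ≤ B) :
    (tester n R H s m t T M₁ M₂).prob f D (· = true) ≤ (s + 1) * (1 - α) ^ m + B := by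
  refine prob_andThen_le_of_forall fun π => ?_
  have h1 := prob_search_le (π := π) (f := f) (D := D) hα m (s + 1) fun _ => none
  push_cast at h1
  refine (prob_andThen_le _ hB fun o ho => ?_).trans (add_le_add_left h1 B)
  split
  · rw [prob_ret]
    simpa using hB
  · rename_i st
    split_ifs with hs
    · refine h π st hs ?_
      by_contra! hc
      exact ho ⟨st, rfl, hc⟩
    · rw [prob_ret]
      simpa using hB

end Soundness

/-! ## Testing families of classes -/

/-- What the tester needs of a family of classes of functions: it is closed under substituting
variables and the constant `0` for variables, the functions depend on at most `s` variables, and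
there are few functions. -/
structure ConciseFamily (s : ℕ) (C : ∀ m, Set (BoolFn m)) : Prop where
  subst : ∀ {m m' : ℕ} {f : BoolFn m}, f ∈ C m → 0 < m' → ∀ σ : Fin m → Option (Fin m'),
    (fun y => f fun i => (σ i).elim false y) ∈ C m'
  junta : ∀ {m : ℕ} {f : BoolFn m}, f ∈ C m → ∃ S : Finset (Fin m), S.card ≤ s ∧ DependsOnly f S
  ncard_le : ∀ m, (C m).ncard ≤ ((m + 2) * (s + 1) ^ 2) ^ (2 * s)
  eq_empty : s = 0 → ∀ m, C m = ∅

namespace ConciseFamily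

open Proc

variable {n s : ℕ} {C : ∀ m, Set (BoolFn m)} {ε : ℝ}

/-- For completeness: a member supplies its own consistent candidate over the colours. -/
lemma blowUp_mem (hC : ConciseFamily s C) {f : BoolFn n} (hf : f ∈ C n) {R : ℕ}
    (π : Fin n → Fin (2 ^ R)) (st : Found n R) : (fun y => f (blowUp π st y)) ∈ C (2 ^ R) := by
  convert hC.subst hf (Nat.two_pow_pos R) fun i => if (st (π i)).isSome then some (π i) else none
    using 3 with y
  ext i
  by_cases h : (st (π i)).isSome <;> simp [blowUp, h]

/-- For soundness: distance from the class bounds the distance from every candidate's pullback. -/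
lemma readOff_mem (hC : ConciseFamily s C) {R : ℕ} {G : BoolFn (2 ^ R)} (hG : G ∈ C (2 ^ R))
    (hn : 0 < n) (st : Found n R) (τ : Fin (2 ^ R) → Fin n) :
    (fun x => G (readOff st τ x)) ∈ C n := by
  convert hC.subst hG hn fun c => if (st c).isSome then some (τ c) else none using 3 with x
  ext c
  by_cases h : (st c).isSome <;> simp [readOff, h]

end ConciseFamily

/-! ### Choice of parameters and the resulting error bounds. -/

section Parameters

/-- The reciprocal of the accuracy, rounded up. -/
noncomputable def accuracy (ε : ℝ) : ℕ := ⌈1 / ε⌉₊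

/-- The logarithmic parameter of the tester. -/
noncomputable def logParam (s : ℕ) (ε : ℝ) : ℕ := Nat.log 2 (s * accuracy ε) + 1

variable {s : ℕ} {ε : ℝ}

lemma accuracy_pos (hε : 0 < ε) : 0 < accuracy ε := Nat.ceil_pos.2 (by positivity)

lemma one_le_mul_accuracy (hε : 0 < ε) : 1 ≤ ε * accuracy ε := by
  have h := Nat.le_ceil (1 / ε)
  rwa [div_le_iff₀ hε, mul_comm] at h

lemma accuracy_le (hε : 0 < ε) (hε1 : ε ≤ 1) : (accuracy ε : ℝ) ≤ 2 / ε := by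
  have h := (Nat.ceil_lt_add_one (a := 1 / ε) (by positivity)).le
  have h1 : 1 ≤ 1 / ε := by rwa [le_div_iff₀ hε, one_mul]
  have h2 : 2 / ε = 1 / ε + 1 / ε := by ring
  rw [accuracy, h2]
  linarith

lemma mul_accuracy_lt (s : ℕ) (ε : ℝ) : s * accuracy ε < 2 ^ logParam s ε :=
  Nat.lt_pow_succ_log_self (by norm_num) _

lemma lt_two_pow_logParam (hε : 0 < ε) : s < 2 ^ logParam s ε :=
  (Nat.le_mul_of_pos_right s (accuracy_pos hε)).trans_lt (mul_accuracy_lt s ε)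

lemma one_le_log_add_two {T : ℝ} (hT : 1 ≤ T) : 1 ≤ Real.log (T + 2) := by
  rw [Real.le_log_iff_exp_le (by linarith)]
  have := Real.exp_one_lt_d9
  linarith

lemma logParam_le (hs : 1 ≤ s) (hε : 0 < ε) (hε1 : ε ≤ 1) :
    (logParam s ε : ℝ) ≤ 4 * Real.log (s / ε + 2) := by
  have hs' : (1 : ℝ) ≤ s := by exact_mod_cast hs
  have hT : (1 : ℝ) ≤ s / ε := by rw [le_div_iff₀ hε]; linarith
  have hL := one_le_log_add_two hT
  have h1 : 2 ^ Nat.log 2 (s * accuracy ε) ≤ s * accuracy ε :=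
    Nat.pow_log_le_self 2 (Nat.mul_pos hs (accuracy_pos hε)).ne'
  have h2 : (2 : ℝ) ^ Nat.log 2 (s * accuracy ε) ≤ 2 * (s / ε + 2) := by
    have h3 : ((2 ^ Nat.log 2 (s * accuracy ε) : ℕ) : ℝ) ≤ ((s * accuracy ε : ℕ) : ℝ) := by
      exact_mod_cast h1
    push_cast at h3
    have h4 : (s : ℝ) * accuracy ε ≤ s * (2 / ε) :=
      mul_le_mul_of_nonneg_left (accuracy_le hε hε1) (by linarith)
    have h5 : (s : ℝ) * (2 / ε) = 2 * (s / ε) := by ring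
    linarith
  have h6 := Real.log_le_log (by positivity) h2
  rw [Real.log_pow, Real.log_mul (by norm_num) (by linarith)] at h6
  have h7 := Real.log_two_gt_d9
  have h8 := Real.log_two_lt_d9
  have h9 : (0 : ℝ) ≤ Nat.log 2 (s * accuracy ε) := Nat.cast_nonneg _
  rw [logParam]
  push_cast
  nlinarith

/-- From `1 - u ≤ exp (-u)`, `1 ≤ ε * accuracy ε` and `exp (-1) ≤ 1 / 2`. -/
lemma one_sub_pow_le (hε : 0 < ε) (hε1 : ε ≤ 1) (k : ℕ) :
    (1 - ε / 4) ^ (4 * accuracy ε * k) ≤ (1 / 2) ^ k := by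
  rw [pow_mul]
  refine pow_le_pow_left₀ (pow_nonneg (by linarith) _) ?_ k
  have h1 : 1 - ε / 4 ≤ Real.exp (-(ε / 4)) := by
    have := Real.add_one_le_exp (-(ε / 4))
    linarith
  have h2 : (1 - ε / 4) ^ (4 * accuracy ε) ≤ Real.exp (-(ε / 4)) ^ (4 * accuracy ε) :=
    pow_le_pow_left₀ (by linarith) h1 _
  rw [← Real.exp_nat_mul] at h2
  have h3 : Real.exp (((4 * accuracy ε : ℕ) : ℝ) * -(ε / 4)) ≤ Real.exp (-1) := by
    refine Real.exp_le_exp.2 ?_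
    have := one_le_mul_accuracy hε
    push_cast
    linarith
  have h4 : Real.exp (-1) ≤ 1 / 2 := by
    rw [Real.exp_neg, one_div]
    refine inv_anti₀ (by norm_num) ?_
    have := Real.exp_one_gt_d9
    linarith
  linarith

lemma search_error_le (hε : 0 < ε) (hε1 : ε ≤ 1) :
    ((s : ℝ) + 1) * (1 - ε / 4) ^ (4 * accuracy ε * (logParam s ε + 3)) ≤ 1 / 8 := by
  have h1 : (s : ℝ) + 1 ≤ 2 ^ logParam s ε := by
    exact_mod_cast lt_two_pow_logParam (s := s) hε
  calc _ ≤ (2 : ℝ) ^ logParam s ε * (1 / 2) ^ (logParam s ε + 3) :=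
        mul_le_mul h1 (one_sub_pow_le hε hε1 _) (pow_nonneg (by linarith) _) (by positivity)
    _ = 1 / 8 := by
        rw [pow_add, ← mul_assoc, ← mul_pow]
        norm_num

lemma read_error_le (hε : 0 < ε) {k : ℕ} (hk : k ≤ s) :
    (k : ℝ) * (1 / 16) ^ (logParam s ε + 1) ≤ ε / 4 := by
  have h1 : (s : ℝ) * accuracy ε ≤ 2 ^ logParam s ε := by
    exact_mod_cast (mul_accuracy_lt s ε).le
  have h2 : (k : ℝ) ≤ s := by exact_mod_cast hk
  have h3 := one_le_mul_accuracy hε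
  have h0 : (0 : ℝ) ≤ s := Nat.cast_nonneg s
  have h4 : (k : ℝ) ≤ ε * 2 ^ logParam s ε := by
    nlinarith [mul_le_mul_of_nonneg_left h3 h0, mul_le_mul_of_nonneg_left h1 hε.le]
  calc _ ≤ ε * 2 ^ logParam s ε * (1 / 16) ^ (logParam s ε + 1) :=
        mul_le_mul_of_nonneg_right h4 (by positivity)
    _ = ε * ((1 / 8) ^ logParam s ε * (1 / 16)) := by
        rw [pow_succ, mul_assoc, ← mul_assoc ((2 : ℝ) ^ _), ← mul_pow]
        norm_num
    _ ≤ ε * (1 * (1 / 16)) := by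
        gcongr
        exact pow_le_one₀ (by norm_num) (by norm_num)
    _ ≤ ε / 4 := by linarith

/-- With `l = logParam s ε`, the base of the counting bound is at most `2 ^ (2 * l + 3) * 2 ^ (2 *
l) ≤ 2 ^ (7 * l)`, and its exponent is `2 * s`. The extra 3 in the number of batches leaves `1 / 8`.
-/
lemma ConciseFamily.count_error_le {C : ∀ m, Set (BoolFn m)} (hC : ConciseFamily s C)
    (hε : 0 < ε) (hε1 : ε ≤ 1) :
    ((C (2 ^ (2 * logParam s ε + 2))).ncard : ℝ) *
      (1 - ε / 4) ^ (4 * accuracy ε * (14 * logParam s ε * s + 3)) ≤ 1 / 8 := by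
  have h1 : (C (2 ^ (2 * logParam s ε + 2))).ncard ≤ 2 ^ (14 * logParam s ε * s) := by
    refine (hC.ncard_le _).trans ?_
    have hl : 1 ≤ logParam s ε := Nat.succ_le_succ (Nat.zero_le _)
    have h2 : (2 ^ (2 * logParam s ε + 2) + 2) * (s + 1) ^ 2 ≤ 2 ^ (7 * logParam s ε) := by
      have h3 : 2 ^ (2 * logParam s ε + 2) + 2 ≤ 2 ^ (2 * logParam s ε + 3) := by
        have : 2 ^ 1 ≤ 2 ^ (2 * logParam s ε + 2) :=
          Nat.pow_le_pow_right (by norm_num) (by omega)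
        rw [pow_succ _ (2 * logParam s ε + 2)]
        omega
      have h4 : (s + 1) ^ 2 ≤ 2 ^ (2 * logParam s ε) := by
        rw [mul_comm, pow_mul]
        exact Nat.pow_le_pow_left (lt_two_pow_logParam hε) 2
      refine (Nat.mul_le_mul h3 h4).trans ?_
      rw [← pow_add]
      exact Nat.pow_le_pow_right (by norm_num) (by omega)
    refine (Nat.pow_le_pow_left h2 _).trans (le_of_eq ?_)
    rw [← pow_mul]
    ring_nf
  have h5 : ((C (2 ^ (2 * logParam s ε + 2))).ncard : ℝ) ≤ 2 ^ (14 * logParam s ε * s) := by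
    exact_mod_cast h1
  calc _ ≤ (2 : ℝ) ^ (14 * logParam s ε * s) * (1 / 2) ^ (14 * logParam s ε * s + 3) :=
        mul_le_mul h5 (one_sub_pow_le hε hε1 _) (pow_nonneg (by linarith) _) (by positivity)
    _ = 1 / 8 := by
        rw [pow_add, ← mul_assoc, ← mul_pow]
        norm_num

end Parameters

/-! ### Assembly of the testers for a concise family. -/

namespace ConciseFamily

open Proc

variable {n s : ℕ} {C : ∀ m, Set (BoolFn m)} {ε : ℝ}

lemma two_thirds_le {x : ENNReal} (hx : x ≠ ⊤) (h : 2 / 3 ≤ x.toReal) : 2 / 3 ≤ x := by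
  rw [← ENNReal.toReal_le_toReal (ENNReal.div_ne_top (by norm_num) (by norm_num)) hx,
    ENNReal.toReal_div]
  simpa using h

/-- The tester with the parameters fixed by `s` and `ε`. -/
noncomputable def standardTester (n s : ℕ) (C : ∀ m, Set (BoolFn m)) (ε : ℝ) (M₁ M₂ : ℕ) :
    Proc n Bool :=
  tester n (2 * logParam s ε + 2) (C _) s (4 * accuracy ε * (logParam s ε + 3)) 96
    (logParam s ε) M₁ M₂

/-- With `α = ε / 4`, a far function is accepted with probability at most `1 / 8` from the search
plus `1 / 8` from the verification. Members use `4 * s ^ 2 ≤ 2 ^ (2 * l + 2)` for `l = logParam s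
ε`, as `s < 2 ^ l`. -/
lemma testsUnder_standardTester (hC : ConciseFamily s C) (hn : 0 < n) (hε : 0 < ε) (hε1 : ε ≤ 1)
    {M₁ M₂ : ℕ} {D : PMF (Fin n → Bool)}
    (h : ∀ (f : BoolFn n) (π : Fin n → Fin (2 ^ (2 * logParam s ε + 2))) (st : Found n _),
      st.colors.card * (1 / 16) ^ (logParam s ε + 1) ≤ ε / 4 →
      disagreement D f (fun x => f (restrictTo π st x)) ≤ ε / 4 →
      (∀ G ∈ C (2 ^ (2 * logParam s ε + 2)), ∀ τ,
        4 * (ε / 4) ≤ disagreement D f fun x => G (readOff st τ x)) →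
      (verify π st (C _) 96 (logParam s ε) M₁ M₂).prob f D (· = true) ≤ 1 / 8) :
    TestsUnder (standardTester n s C ε M₁ M₂).toAlg (C n) ε D := by
  refine ⟨fun f hf => two_thirds_le (PMF.apply_ne_top _ _) ?_,
    fun f hf => two_thirds_le (PMF.apply_ne_top _ _) ?_⟩
  · rw [run_toAlg]
    obtain ⟨S, hS, hd⟩ := hC.junta hf
    refine prob_tester_ge hd hS ?_ (fun π st => hC.blowUp_mem hf π st) _ _ _ _ _
    have h1 := (lt_two_pow_logParam (s := s) hε).le
    calc 4 * s ^ 2 ≤ 4 * (2 ^ logParam s ε) ^ 2 := by gcongr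
      _ = 2 ^ (2 * logParam s ε + 2) := by ring
  · rw [run_toAlg]
    have h1 : (standardTester n s C ε M₁ M₂).prob f D (· = true) ≤ _ :=
      prob_tester_le (α := ε / 4) (B := 1 / 8) (by linarith) (by norm_num) fun π st hst hdis =>
        h f π st (read_error_le hε hst) hdis fun G hG τ => by
          rw [mul_div_cancel₀ _ (by norm_num : (4 : ℝ) ≠ 0)]
          exact hf _ (hC.readOff_mem hG hn st τ)
    have h2 := search_error_le (s := s) hε hε1
    have h3 := prob_not (f := f) (D := D) (standardTester n s C ε M₁ M₂) (· = true)
    simp only [Bool.not_eq_true] at h3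
    linarith

lemma uniformTester_of_pos (hC : ConciseFamily s C) (hn : 0 < n) (hε : 0 < ε) (hε1 : ε ≤ 1) :
    IsUniformTester (standardTester n s C ε (4 * accuracy ε * 3)
      (4 * accuracy ε * (14 * logParam s ε * s + 3))).toAlg (C n) ε := by
  have : Nonempty (Fin n) := ⟨⟨0, hn⟩⟩
  refine hC.testsUnder_standardTester hn hε hε1 fun f π st h1 h2 h3 =>
    prob_verify_le_uniform h1 rfl h2 h3 (by norm_num) ?_ (hC.count_error_le hε hε1)
  exact (one_sub_pow_le hε hε1 3).trans (by norm_num)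

lemma distributionFreeTester_of_pos (hC : ConciseFamily s C) (hn : 0 < n) (hε : 0 < ε)
    (hε1 : ε ≤ 1) :
    IsDistributionFreeTester (standardTester n s C ε
      (4 * accuracy ε * (14 * logParam s ε * s + 3)) 0).toAlg (C n) ε := by
  have : Nonempty (Fin n) := ⟨⟨0, hn⟩⟩
  exact fun D => hC.testsUnder_standardTester hn hε hε1 fun f π st h1 h2 h3 =>
    prob_verify_le 0 h1 h2 h3 (by norm_num) (hC.count_error_le hε hε1)

-- Below `T = 1` the claimed bound may be less than one query, so these cases must be decided for
-- free: the class is empty, or nothing is `ε`-far from a nonempty class. For `n = 0` no dummy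
-- variable is available, but one query determines `f`.
open Classical in
lemma degenerate (hC : ConciseFamily s C) (hε : 0 < ε) (h : s = 0 ∨ 1 < ε ∨ n = 0) :
    ∃ A : QueryAlg n, IsDistributionFreeTester A (C n) ε ∧
      ∀ f : BoolFn n, A.queries f ≤ if s ≠ 0 ∧ ε ≤ 1 then 1 else 0 := by
  have htriv : ∀ f : BoolFn n, ∀ D b, (QueryAlg.output b).run f D b = 1 := fun f D b => by
    simp [QueryAlg.run]
  have h23 : (2 / 3 : ENNReal) ≤ 1 := two_thirds_le (by norm_num) (by norm_num)
  by_cases hemp : C n = ∅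
  · refine ⟨.output false, fun D => ⟨fun f hf => ?_, fun f _ => ?_⟩, fun f => Nat.zero_le _⟩
    · rw [hemp] at hf
      exact absurd hf (Set.notMem_empty f)
    · rw [htriv]; exact h23
  have hs : s ≠ 0 := fun hs => hemp (hC.eq_empty hs n)
  by_cases hε1 : 1 < ε
  · obtain ⟨g, hg⟩ := Set.nonempty_iff_ne_empty.2 hemp
    refine ⟨.output true, fun D => ⟨fun f _ => ?_, fun f hf => ?_⟩, fun f => Nat.zero_le _⟩
    · rw [htriv]; exact h23
    · exact absurd (hf g hg) (not_le.2 ((disagreement_le_one D f g).trans_lt hε1))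
  have hn : n = 0 := (h.resolve_left hs).resolve_left hε1
  subst hn
  have hf0 : ∀ f : BoolFn 0, (fun _ => f fun _ => false) = f := fun f => by
    ext x
    exact congrArg f (Subsingleton.elim _ _)
  refine ⟨.memQuery (fun _ => false) fun b => .output (decide ((fun _ => b) ∈ C 0)),
    fun D => ⟨fun f hf => ?_, fun f hf => ?_⟩, fun f => ?_⟩
  · simp only [QueryAlg.run, hf0, hf, decide_true, PMF.pure_apply_self]
    exact h23
  · have hfC : f ∉ C 0 := fun hc => by
      have := hf f hc
      simp only [disagreement, ne_eq, not_true_eq_false, Finset.filter_false,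
        Finset.sum_empty] at this
      linarith
    simp only [QueryAlg.run, hf0, hfC, decide_false, PMF.pure_apply_self]
    exact h23
  · rw [if_pos ⟨hs, not_lt.1 hε1⟩]
    exact le_rfl

lemma cost_standardTester_uniform_le (hs : 1 ≤ s) (hε : 0 < ε) (f : BoolFn n) :
    (standardTester n s C ε (4 * accuracy ε * 3)
      (4 * accuracy ε * (14 * logParam s ε * s + 3))).cost f ≤
      1500 * (s * accuracy ε * logParam s ε) := by
  refine (cost_tester_le _ _ _ _ _ _ _).trans ?_
  have hE := accuracy_pos hε
  have hl : 1 ≤ logParam s ε := Nat.succ_le_succ (Nat.zero_le _)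
  generalize accuracy ε = E at *
  generalize logParam s ε = l at *
  -- Writing each parameter as 1 plus a natural number reduces the bound to comparing coefficients
  -- of monomials, which `omega` treats as atoms.
  obtain ⟨a, rfl⟩ := Nat.exists_eq_add_of_le hs
  obtain ⟨b, rfl⟩ := Nat.exists_eq_add_of_le (show 1 ≤ E from hE)
  obtain ⟨c, rfl⟩ := Nat.exists_eq_add_of_le hl
  ring_nf
  omega

lemma cost_standardTester_distributionFree_le (hs : 1 ≤ s) (hε : 0 < ε) (f : BoolFn n) :
    (standardTester n s C ε (4 * accuracy ε * (14 * logParam s ε * s + 3)) 0).cost f ≤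
      2000 * (s ^ 2 * accuracy ε * logParam s ε ^ 2) := by
  refine (cost_tester_le _ _ _ _ _ _ _).trans ?_
  have hE := accuracy_pos hε
  have hl : 1 ≤ logParam s ε := Nat.succ_le_succ (Nat.zero_le _)
  generalize accuracy ε = E at *
  generalize logParam s ε = l at *
  obtain ⟨a, rfl⟩ := Nat.exists_eq_add_of_le hs
  obtain ⟨b, rfl⟩ := Nat.exists_eq_add_of_le (show 1 ≤ E from hE)
  obtain ⟨c, rfl⟩ := Nat.exists_eq_add_of_le hl
  ring_nf
  omega

lemma degenerate_bound {T K : ℝ} {c q : ℕ} (hK : 1 ≤ K) (hT0 : 0 ≤ T)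
    (hT : s ≠ 0 ∧ ε ≤ 1 → 1 ≤ T) [Decidable (s ≠ 0 ∧ ε ≤ 1)]
    (hq : q ≤ if s ≠ 0 ∧ ε ≤ 1 then 1 else 0) :
    (q : ℝ) ≤ softO K c T := by
  split_ifs at hq with h
  · have h1 := hT h
    have h2 : 1 ≤ Real.log (T + 2) ^ c := one_le_pow₀ (one_le_log_add_two h1)
    have h3 : (q : ℝ) ≤ 1 := by exact_mod_cast hq
    rw [softO]
    have h4 : 1 ≤ T * Real.log (T + 2) ^ c := one_le_mul_of_one_le_of_one_le h1 h2
    exact h3.trans (one_le_mul_of_one_le_of_one_le hK h4)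
  · have h0 : q = 0 := Nat.le_zero.1 hq
    have h1 : 0 ≤ Real.log (T + 2) := Real.log_nonneg (by linarith)
    rw [h0, softO]
    push_cast
    positivity

theorem exists_uniformTester (hC : ConciseFamily s C) (n : ℕ) (hε : 0 < ε) :
    ∃ A : QueryAlg n, IsUniformTester A (C n) ε ∧
      ∀ f : BoolFn n, (A.queries f : ℝ) ≤ softO 12000 1 ((s : ℝ) / ε) := by
  classical
  by_cases h : s = 0 ∨ 1 < ε ∨ n = 0
  · obtain ⟨A, hA, hq⟩ := hC.degenerate hε h
    refine ⟨A, hA _, fun f => degenerate_bound (by norm_num) (by positivity) ?_ (hq f)⟩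
    rintro ⟨hs, hε1⟩
    have hs' : (1 : ℝ) ≤ s := by exact_mod_cast Nat.one_le_iff_ne_zero.2 hs
    rw [le_div_iff₀ hε]
    linarith
  push Not at h
  obtain ⟨hs, hε1, hn⟩ := h
  have hs1 : 1 ≤ s := Nat.one_le_iff_ne_zero.2 hs
  refine ⟨_, hC.uniformTester_of_pos (Nat.pos_of_ne_zero hn) hε hε1, fun f => ?_⟩
  rw [queries_toAlg]
  have h1 : ((standardTester n s C ε (4 * accuracy ε * 3)
      (4 * accuracy ε * (14 * logParam s ε * s + 3))).cost f : ℝ) ≤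
      1500 * (s * accuracy ε * logParam s ε) := by
    exact_mod_cast cost_standardTester_uniform_le hs1 hε f
  refine h1.trans ?_
  calc 1500 * ((s : ℝ) * accuracy ε * logParam s ε)
      ≤ 1500 * (s * (2 / ε) * (4 * Real.log (s / ε + 2))) := by
        gcongr
        · exact accuracy_le hε hε1
        · exact logParam_le hs1 hε hε1
    _ = softO 12000 1 ((s : ℝ) / ε) := by
        rw [softO]
        ring

theorem exists_distributionFreeTester (hC : ConciseFamily s C) (n : ℕ) (hε : 0 < ε) :
    ∃ A : QueryAlg n, IsDistributionFreeTester A (C n) ε ∧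
      ∀ f : BoolFn n, (A.queries f : ℝ) ≤ softO 64000 2 ((s : ℝ) ^ 2 / ε) := by
  classical
  by_cases h : s = 0 ∨ 1 < ε ∨ n = 0
  · obtain ⟨A, hA, hq⟩ := hC.degenerate hε h
    refine ⟨A, hA, fun f => degenerate_bound (by norm_num) (by positivity) ?_ (hq f)⟩
    rintro ⟨hs, hε1⟩
    have hs' : (1 : ℝ) ≤ s := by exact_mod_cast Nat.one_le_iff_ne_zero.2 hs
    rw [le_div_iff₀ hε]
    nlinarith
  push Not at h
  obtain ⟨hs, hε1, hn⟩ := h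
  have hs1 : 1 ≤ s := Nat.one_le_iff_ne_zero.2 hs
  have hs' : (1 : ℝ) ≤ s := by exact_mod_cast hs1
  refine ⟨_, hC.distributionFreeTester_of_pos (Nat.pos_of_ne_zero hn) hε hε1, fun f => ?_⟩
  rw [queries_toAlg]
  have h1 : ((standardTester n s C ε (4 * accuracy ε * (14 * logParam s ε * s + 3)) 0).cost f : ℝ) ≤
      2000 * (s ^ 2 * accuracy ε * logParam s ε ^ 2) := by
    exact_mod_cast cost_standardTester_distributionFree_le hs1 hε f
  refine h1.trans ?_
  have h2 : Real.log (s / ε + 2) ≤ Real.log ((s : ℝ) ^ 2 / ε + 2) := by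
    refine Real.log_le_log (by positivity) ?_
    gcongr
    nlinarith
  calc 2000 * ((s : ℝ) ^ 2 * accuracy ε * logParam s ε ^ 2)
      ≤ 2000 * (s ^ 2 * (2 / ε) * (4 * Real.log ((s : ℝ) ^ 2 / ε + 2)) ^ 2) := by
        gcongr
        · exact accuracy_le hε hε1
        · exact (logParam_le hs1 hε hε1).trans (by linarith)
    _ = softO 64000 2 ((s : ℝ) ^ 2 / ε) := by
        rw [softO]
        ring

end ConciseFamily

/-! ## Decision trees and branching programs -/

namespace DecisionTree

variable {n m : ℕ}

lemma size_pos (T : DecisionTree n) : 0 < T.size := by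
  induction T with
  | leaf b => simp [size]
  | node i l r ihl ihr => simp [size]; omega

/-- Split a leaf into two equal leaves by a dummy test of `i`. -/
lemma exists_size_succ (i : Fin n) (T : DecisionTree n) :
    ∃ T' : DecisionTree n, T'.size = T.size + 1 ∧ T'.eval = T.eval := by
  induction T with
  | leaf b => exact ⟨node i (leaf b) (leaf b), rfl, by ext x; simp [eval]⟩
  | node j l r ihl ihr =>
    obtain ⟨l', h1, h2⟩ := ihl
    exact ⟨node j l' r, by simp only [size, h1]; omega, by ext x; simp [eval, h2]⟩

lemma exists_pad (i : Fin n) (T : DecisionTree n) (k : ℕ) :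
    ∃ T' : DecisionTree n, T'.size = T.size + k ∧ T'.eval = T.eval := by
  induction k with
  | zero => exact ⟨T, rfl, rfl⟩
  | succ k ih =>
    obtain ⟨T', h1, h2⟩ := ih
    obtain ⟨T'', h3, h4⟩ := exists_size_succ i T'
    exact ⟨T'', by omega, h4.trans h2⟩

/-- A test of a variable set to 0 collapses to its left subtree. The class demands exact size, so
the lost right leaves are restored by padding, which is why a variable `i` must exist. -/
lemma exists_subst (i : Fin m) (σ : Fin n → Option (Fin m)) (T : DecisionTree n) :
    ∃ T' : DecisionTree m, T'.size = T.size ∧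
      T'.eval = fun y => T.eval fun i => (σ i).elim false y := by
  induction T with
  | leaf b => exact ⟨leaf b, rfl, rfl⟩
  | node j l r ihl ihr =>
    obtain ⟨l', hl, hl'⟩ := ihl
    obtain ⟨r', hr, hr'⟩ := ihr
    cases hj : σ j with
    | none =>
      obtain ⟨T', h1, h2⟩ := exists_pad i l' r.size
      refine ⟨T', by rw [h1, hl]; rfl, ?_⟩
      rw [h2, hl']
      ext y
      simp [eval, hj]
    | some k =>
      refine ⟨node k l' r', by simp [size, hl, hr], ?_⟩
      ext y
      simp [eval, hj, hl', hr']

/-- The variables that label the nodes. -/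
def vars : DecisionTree n → Finset (Fin n)
  | leaf _ => ∅
  | node i l r => insert i (l.vars ∪ r.vars)

lemma card_vars_lt (T : DecisionTree n) : T.vars.card < T.size := by
  induction T with
  | leaf b => simp [vars, size]
  | node i l r ihl ihr =>
    have h1 := Finset.card_insert_le i (l.vars ∪ r.vars)
    have h2 := Finset.card_union_le l.vars r.vars
    simp only [vars, size]
    omega

lemma dependsOnly_vars (T : DecisionTree n) : DependsOnly T.eval T.vars := by
  induction T with
  | leaf b => exact fun _ _ _ => rfl
  | node i l r ihl ihr =>
    intro x y h
    have h1 := ihl x y fun j hj => h j (by simp [vars, hj])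
    have h2 := ihr x y fun j hj => h j (by simp [vars, hj])
    have h3 := h i (by simp [vars])
    simp only [eval, h1, h2, h3]

/-- Preorder traversal. -/
def code : DecisionTree n → List (Fin n ⊕ Bool)
  | leaf b => [Sum.inr b]
  | node i l r => Sum.inl i :: (l.code ++ r.code)

lemma length_code (T : DecisionTree n) : T.code.length + 1 = 2 * T.size := by
  induction T with
  | leaf b => rfl
  | node i l r ihl ihr =>
    simp only [code, size, List.length_cons, List.length_append]
    omega

/-- Preorder codes are prefix-free; the tails `u`, `v` are what lets the induction pass from the
left subtree to the right one. -/
lemma code_append_inj (T T' : DecisionTree n) (u v : List (Fin n ⊕ Bool))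
    (h : T.code ++ u = T'.code ++ v) : T = T' ∧ u = v := by
  induction T generalizing T' u v with
  | leaf b =>
    cases T' with
    | leaf b' => simpa [code] using h
    | node i l r => simp [code] at h
  | node i l r ihl ihr =>
    cases T' with
    | leaf b' => simp [code] at h
    | node i' l' r' =>
      simp only [code, List.cons_append, List.append_assoc, List.cons.injEq, Sum.inl.injEq] at h
      obtain ⟨hl, h1⟩ := ihl _ _ _ h.2
      obtain ⟨hr, h2⟩ := ihr _ _ _ h1
      exact ⟨by rw [h.1, hl, hr], h2⟩

lemma code_injective : Function.Injective (code (n := n)) := fun T T' h =>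
  (code_append_inj T T' [] [] (by rw [h])).1

lemma ncard_le (n s : ℕ) : (sizeDecisionTree n s).ncard ≤ (n + 2) ^ (2 * s) := by
  classical
  have h1 : ∀ f : sizeDecisionTree n s, ∃ v : List.Vector (Fin n ⊕ Bool) (2 * s - 1),
      ∃ T : DecisionTree n, T.code = v.1 ∧ T.eval = f.1 := by
    rintro ⟨f, T, hT, hf⟩
    have := T.length_code
    exact ⟨⟨T.code, by omega⟩, T, rfl, hf⟩
  choose v hv using h1
  have h2 : Function.Injective v := by
    intro f g hfg
    obtain ⟨T, hT, hf⟩ := hv f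
    obtain ⟨T', hT', hg⟩ := hv g
    rw [hfg, ← hT'] at hT
    exact Subtype.ext (by rw [← hf, ← hg, code_injective hT])
  have h3 := Nat.card_le_card_of_injective v h2
  rw [Nat.card_coe_set_eq, Nat.card_eq_fintype_card, card_vector] at h3
  simp only [Fintype.card_sum, Fintype.card_fin, Fintype.card_bool] at h3
  exact h3.trans (Nat.pow_le_pow_right (by omega) (by omega))

end DecisionTree

theorem conciseFamily_decisionTree (s : ℕ) : ConciseFamily s fun m => sizeDecisionTree m s where
  subst := by
    rintro m m' _ ⟨T, hT, rfl⟩ hm' σ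
    obtain ⟨T', h1, h2⟩ := T.exists_subst ⟨0, hm'⟩ σ
    exact ⟨T', h1.trans hT, h2⟩
  junta := by
    rintro m _ ⟨T, rfl, rfl⟩
    exact ⟨T.vars, T.card_vars_lt.le, T.dependsOnly_vars⟩
  ncard_le m := by
    refine (DecisionTree.ncard_le m s).trans (Nat.pow_le_pow_left ?_ _)
    exact Nat.le_mul_of_pos_right _ (by positivity)
  eq_empty := by
    rintro rfl m
    refine Set.eq_empty_of_forall_notMem ?_
    rintro _ ⟨T, hT, -⟩
    exact absurd hT T.size_pos.ne'

/-! ### Branching programs form a concise family. -/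

namespace BranchingProgram

variable {n m s : ℕ}

lemma step_eq {P : BranchingProgram n s} {x : Fin n → Bool} {u v w : Fin s}
    (h : P.Step x u v) (h' : P.Step x u w) : v = w := by
  obtain ⟨i, child, h1, rfl⟩ := h
  obtain ⟨i', child', h1', rfl⟩ := h'
  rw [h1] at h1'
  cases h1'
  rfl

/-- The node obtained by substituting variables and the constant `0` for the variables. -/
def substNode (i : Fin m) (σ : Fin n → Option (Fin m)) : BPNode n s → BPNode m s
  | .sink b => .sink b
  | .branch j child =>
    match σ j with
    -- Both edges follow the value 0 under a dummy label, so the node count and the two sinks are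
    -- untouched.
    | none => .branch i fun _ => child false
    | some k => .branch k child

lemma substNode_eq_sink {i : Fin m} {σ : Fin n → Option (Fin m)} {N : BPNode n s} {b : Bool} :
    substNode i σ N = .sink b ↔ N = .sink b := by
  cases N with
  | sink b' => simp [substNode]
  | branch j child =>
    simp only [substNode]
    split <;> simp

lemma exists_of_substNode_eq_branch {i k : Fin m} {σ : Fin n → Option (Fin m)} {N : BPNode n s}
    {child : Bool → Fin s} (h : substNode i σ N = .branch k child) :
    ∃ j child', N = .branch j child' ∧ ∀ b, ∃ b', child b = child' b' := by
  cases N with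
  | sink b' => simp [substNode] at h
  | branch j child' =>
    refine ⟨j, child', rfl, fun b => ?_⟩
    simp only [substNode] at h
    split at h
    · cases h; exact ⟨false, rfl⟩
    · cases h; exact ⟨b, rfl⟩

/-- Substitution of variables and the constant `0` for the variables. -/
def subst (P : BranchingProgram n s) (i : Fin m) (σ : Fin n → Option (Fin m)) :
    BranchingProgram m s where
  node v := substNode i σ (P.node v)
  root := P.root
  existsUnique_sink b := by
    simp only [substNode_eq_sink]
    exact P.existsUnique_sink b
  acyclic v hv := by
    refine P.acyclic v (Relation.TransGen.mono ?_ _ _ hv)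
    rintro u w ⟨k, child, b, h, rfl⟩
    obtain ⟨j, child', h1, h2⟩ := exists_of_substNode_eq_branch h
    obtain ⟨b', h3⟩ := h2 b
    exact ⟨j, child', b', h1, h3.symm⟩

lemma subst_computes {P : BranchingProgram n s} {f : BoolFn n} (h : P.Computes f) (i : Fin m)
    (σ : Fin n → Option (Fin m)) :
    (P.subst i σ).Computes fun y => f fun j => (σ j).elim false y := by
  intro y
  obtain ⟨v, hv, hsink⟩ := h fun j => (σ j).elim false y
  refine ⟨v, Relation.ReflTransGen.mono ?_ _ _ hv, substNode_eq_sink.2 hsink⟩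
  rintro u w ⟨j, child, h1, rfl⟩
  cases hj : σ j with
  | none => exact ⟨i, fun _ => child false, by simp [subst, h1, substNode, hj], by simp [hj]⟩
  | some k => exact ⟨k, child, by simp [subst, h1, substNode, hj], by simp [hj]⟩

/-- The variables that label the nodes. -/
def label (P : BranchingProgram n s) (v : Fin s) : Option (Fin n) :=
  match P.node v with
  | .sink _ => none
  | .branch i _ => some i

/-- Two computations that agree end in the same sink. -/
lemma eq_of_reach {P : BranchingProgram n s} {x : Fin n → Bool} {u v w : Fin s} {b c : Bool}
    (hv : Relation.ReflTransGen (P.Step x) u v) (hw : Relation.ReflTransGen (P.Step x) u w)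
    (hb : P.node v = .sink b) (hc : P.node w = .sink c) : b = c := by
  have hend : ∀ {v b}, P.node v = .sink b → ∀ w, ¬ P.Step x v w := by
    rintro v b hb w ⟨i, child, h, -⟩
    rw [hb] at h
    cases h
  induction hv using Relation.ReflTransGen.head_induction_on with
  | refl =>
    rcases Relation.ReflTransGen.cases_head hw with rfl | ⟨z, hz, -⟩
    · rw [hb] at hc; cases hc; rfl
    · exact absurd hz (hend hb z)
  | head h _ ih =>
    rcases Relation.ReflTransGen.cases_head hw with rfl | ⟨z, hz, hzw⟩
    · exact absurd h (hend hc _)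
    · rw [step_eq hz h] at hzw
      exact ih hzw

/-- The computation on `x` reads only labels, so it is also a computation on `y`. -/
lemma computes_dependsOnly {P : BranchingProgram n s} {f : BoolFn n} (h : P.Computes f) :
    DependsOnly f (Finset.univ.filter fun i => ∃ v, P.label v = some i) := by
  intro x y hxy
  obtain ⟨v, hv, hb⟩ := h x
  obtain ⟨w, hw, hc⟩ := h y
  refine eq_of_reach (Relation.ReflTransGen.mono ?_ _ _ hv) hw hb hc
  rintro a b ⟨i, child, h1, rfl⟩
  refine ⟨i, child, h1, ?_⟩
  rw [hxy i]
  simp only [Finset.mem_filter, Finset.mem_univ, true_and]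
  exact ⟨a, by simp [label, h1]⟩

lemma card_labels_le (P : BranchingProgram n s) :
    (Finset.univ.filter fun i => ∃ v, P.label v = some i).card ≤ s := by
  classical
  have h : (Finset.univ.filter fun i => ∃ v, P.label v = some i).map Function.Embedding.some ⊆
      Finset.univ.image P.label := by
    intro o ho
    simp only [Finset.mem_map, Finset.mem_filter, Finset.mem_univ, true_and] at ho
    obtain ⟨i, ⟨v, hv⟩, rfl⟩ := ho
    exact Finset.mem_image.2 ⟨v, Finset.mem_univ v, hv⟩
  have h2 := (Finset.card_le_card h).trans Finset.card_image_le
  simpa using h2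

/-- A node as a sink label or a variable with two endpoints. -/
def nodeCode : BPNode n s → Bool ⊕ (Fin n × (Bool → Fin s))
  | .sink b => Sum.inl b
  | .branch i child => Sum.inr (i, child)

lemma nodeCode_injective : Function.Injective (nodeCode (n := n) (s := s)) := by
  intro a b h
  cases a <;> cases b <;> simp_all [nodeCode]

/-- The node table and the root determine the function: each of the `s` nodes is one of two sinks or
a variable with two endpoints, and there are `s` possible roots. -/
lemma ncard_le (n s : ℕ) :
    (sizeBranchingProgram n s).ncard ≤ (2 + n * s ^ 2) ^ s * s := by
  classical
  have h1 : ∀ f : sizeBranchingProgram n s, ∃ P : BranchingProgram n s, P.Computes f.1 :=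
    fun f => f.2
  choose P hP using h1
  let code (f : sizeBranchingProgram n s) :
      (Fin s → Bool ⊕ (Fin n × (Bool → Fin s))) × Fin s :=
    (fun v => nodeCode ((P f).node v), (P f).root)
  have h2 : Function.Injective code := by
    intro f g hfg
    have hn : (P f).node = (P g).node :=
      funext fun v => nodeCode_injective (congrFun (congrArg Prod.fst hfg) v)
    have hr : (P f).root = (P g).root := congrArg Prod.snd hfg
    refine Subtype.ext (funext fun x => ?_)
    obtain ⟨v, hv, hb⟩ := hP f x
    obtain ⟨w, hw, hc⟩ := hP g x
    rw [hn] at hb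
    rw [hr] at hv
    refine eq_of_reach (Relation.ReflTransGen.mono ?_ _ _ hv) hw hb hc
    rintro a b ⟨i, child, h3, h4⟩
    exact ⟨i, child, by rw [← hn, h3], h4⟩
  have h3 := Nat.card_le_card_of_injective code h2
  rw [Nat.card_coe_set_eq, Nat.card_eq_fintype_card] at h3
  simpa using h3

end BranchingProgram

theorem conciseFamily_branchingProgram (s : ℕ) :
    ConciseFamily s fun m => sizeBranchingProgram m s where
  subst := by
    rintro m m' _ ⟨P, hP⟩ hm' σ
    exact ⟨P.subst ⟨0, hm'⟩ σ, BranchingProgram.subst_computes hP _ σ⟩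
  junta := by
    rintro m _ ⟨P, hP⟩
    exact ⟨_, P.card_labels_le, BranchingProgram.computes_dependsOnly hP⟩
  ncard_le m := by
    refine (BranchingProgram.ncard_le m s).trans ?_
    have h1 : 2 + m * s ^ 2 ≤ (m + 2) * (s + 1) ^ 2 := by
      have : (m + 2) * (s + 1) ^ 2 = 2 + m * s ^ 2 + (2 * m * s + m + 2 * s ^ 2 + 4 * s) := by ring
      omega
    -- The factor `s` for the root is absorbed by a second `s`-th power, giving the exponent `2 * s`
    -- that decision trees need as well.
    have h2 : s ≤ ((m + 2) * (s + 1) ^ 2) ^ s :=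
      (Nat.lt_two_pow_self (n := s)).le.trans (Nat.pow_le_pow_left (by nlinarith) s)
    calc _ ≤ ((m + 2) * (s + 1) ^ 2) ^ s * ((m + 2) * (s + 1) ^ 2) ^ s :=
          Nat.mul_le_mul (Nat.pow_le_pow_left h1 s) h2
      _ = _ := by rw [← pow_add, two_mul]
  eq_empty := by
    rintro rfl m
    refine Set.eq_empty_of_forall_notMem ?_
    rintro _ ⟨P, -⟩
    exact P.root.elim0

theorem mainTheorem6 :
    (∃ (K : ℝ) (c : ℕ), ∀ (n s : ℕ) (ε : ℝ), 0 < ε →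
      ∃ A : QueryAlg n, IsUniformTester A (sizeDecisionTree n s) ε ∧
        ∀ f : BoolFn n, (A.queries f : ℝ) ≤ softO K c ((s : ℝ) / ε)) ∧
    (∃ (K : ℝ) (c : ℕ), ∀ (n s : ℕ) (ε : ℝ), 0 < ε →
      ∃ A : QueryAlg n, IsUniformTester A (sizeBranchingProgram n s) ε ∧
        ∀ f : BoolFn n, (A.queries f : ℝ) ≤ softO K c ((s : ℝ) / ε)) ∧
    (∃ (K : ℝ) (c : ℕ), ∀ (n s : ℕ) (ε : ℝ), 0 < ε →
      ∃ A : QueryAlg n, IsDistributionFreeTester A (sizeDecisionTree n s) ε ∧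
        ∀ f : BoolFn n, (A.queries f : ℝ) ≤ softO K c ((s : ℝ) ^ 2 / ε)) ∧
    (∃ (K : ℝ) (c : ℕ), ∀ (n s : ℕ) (ε : ℝ), 0 < ε →
      ∃ A : QueryAlg n, IsDistributionFreeTester A (sizeBranchingProgram n s) ε ∧
        ∀ f : BoolFn n, (A.queries f : ℝ) ≤ softO K c ((s : ℝ) ^ 2 / ε)) :=
  ⟨⟨_, _, fun n s _ hε => (conciseFamily_decisionTree s).exists_uniformTester n hε⟩,
    ⟨_, _, fun n s _ hε => (conciseFamily_branchingProgram s).exists_uniformTester n hε⟩,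
    ⟨_, _, fun n s _ hε => (conciseFamily_decisionTree s).exists_distributionFreeTester n hε⟩,
    ⟨_, _, fun n s _ hε => (conciseFamily_branchingProgram s).exists_distributionFreeTester n hε⟩⟩
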